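/- Let $\omega>0$, $\gamma>0$ and $L>0$. Let $\mathcal G_L$ be the tadpole graph, formed by a loop identified with $[-L,L]$ and a half-line identified with $[0,\infty)$, where the points $-L$ and $L$ of the loop and $0$ of the half-line are identified to a single vertex $\mathrm v$. A function $v:\mathcal G_L\to\mathbb C$ is a couple $(v_c,v_h)$ of functions on $[-L,L]$ and $[0,\infty)$, with $\|v\|_{L^p(\mathcal G_L)}^p=\int_{-L}^L|v_c|^p\,dx+\int_0^\infty|v_h|^p\,dx$ and $v'=(v_c',v_h')$. Let $$H^1_D(\mathcal G_L)=\{v=(v_c,v_h)\in H^1(-L,L)\oplus H^1(0,\infty): v_c(L)=v_c(-L)=v_h(0)\},$$ where $H^1$ functions are identified with their continuous representatives, and denote by $v(\mathrm v)$ the common value at the vertex. For $v\in H^1_D(\mathcal G_L)$ put $Q_\gamma(v)=\|v'\|_{L^2(\mathcal G_L)}^2+\gamma|v(\mathrm v)|^2$, $$S_{\omega,\gamma,L}(v)=\tfrac12 Q_\gamma(v)+\tfrac\omega2\|v\|_{L^2(\mathcal G_L)}^2-\tfrac14\|v\|_{L^4(\mathcal G_L)}^4,\qquad I_{\omega,\gamma,L}(v)=Q_\gamma(v)+\omega\|v\|_{L^2(\mathcal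 G_L)}^2-\|v\|_{L^4(\mathcal G_L)}^4,$$ and let $$\mathcal N_{\omega,\gamma,L}=\{v\in H^1_D(\mathcal G_L): v\not\equiv0,\ I_{\omega,\gamma,L}(v)=0\},\qquad s_{\omega,\gamma,L}=\inf\{S_{\omega,\gamma,L}(v): v\in\mathcal N_{\omega,\gamma,L}\}.$$ If $$s_{\omega,\gamma,L}<\tfrac43\,\omega^{3/2},$$ then there exists $u\in\mathcal N_{\omega,\gamma,L}$ with $S_{\omega,\gamma,L}(u)=s_{\omega,\gamma,L}$, that is, the action attains its minimum on $\mathcal N_{\omega,\gamma,L}$. -/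

import Mathlib

open Set MeasureTheory


noncomputable section

/-- `g` is a weak derivative of `f` on the open set `I` of the real line: both are locally
integrable on `I`, and `∫_I φ' f = - ∫_I φ g` for every smooth test function `φ` whose support
is a compact subset of `I`. -/
def HasWeakDerivOn (I : Set ℝ) (f g : ℝ → ℂ) : Prop :=
  LocallyIntegrableOn f I ∧ LocallyIntegrableOn g I ∧
    ∀ φ : ℝ → ℝ, ContDiff ℝ (⊤ : ℕ∞) φ → HasCompactSupport φ → tsupport φ ⊆ I →
      ∫ x in I, deriv φ x • f x = -∫ x in I, φ x • g x

/-- Weak derivatives on an open set are unique up to a null set. -/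
theorem HasWeakDerivOn.ae_eq {I : Set ℝ} (hI : IsOpen I) {f g₁ g₂ : ℝ → ℂ}
    (h₁ : HasWeakDerivOn I f g₁) (h₂ : HasWeakDerivOn I f g₂) :
    ∀ᵐ x ∂volume, x ∈ I → g₁ x = g₂ x := by
  have key : ∀ᵐ x ∂volume, x ∈ I → (g₁ - g₂) x = 0 := by
    refine hI.ae_eq_zero_of_integral_contDiff_smul_eq_zero (h₁.2.1.sub h₂.2.1) ?_
    intro φ hφ hc hs
    have hint : ∀ g : ℝ → ℂ, LocallyIntegrableOn g I →
        IntegrableOn (fun x => φ x • g x) I := by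
      intro g hg
      have hK : IntegrableOn (fun x => φ x • g x) (tsupport φ) :=
        (hg.integrableOn_compact_subset hs hc.isCompact).continuousOn_smul
          hφ.continuous.continuousOn hc.isCompact
      refine ((integrableOn_iff_integrable_of_support_subset ?_).1 hK).integrableOn
      intro x hx
      refine subset_tsupport φ ?_
      intro h0
      exact hx (by simp [h0])
    have hset : ∫ x in I, φ x • (g₁ - g₂) x = ∫ x, φ x • (g₁ - g₂) x := by
      refine setIntegral_eq_integral_of_forall_compl_eq_zero ?_
      intro x hx
      have : φ x = 0 := image_eq_zero_of_notMem_tsupport fun h => hx (hs h)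
      simp [this]
    rw [← hset]
    simp only [Pi.sub_apply, smul_sub]
    rw [integral_sub (hint _ h₁.2.1) (hint _ h₂.2.1), sub_eq_zero]
    exact neg_injective ((h₁.2.2 φ hφ hc hs).symm.trans (h₂.2.2 φ hφ hc hs))
  filter_upwards [key] with x hx hxI
  exact sub_eq_zero.1 (hx hxI)

open Classical in
/-- The weak derivative of `f` on `I` (a choice of representative; `0` if there is none). -/
def weakDeriv (I : Set ℝ) (f : ℝ → ℂ) : ℝ → ℂ :=
  if h : ∃ g, HasWeakDerivOn I f g then h.choose else 0

/-- Membership in the Sobolev space `H¹(I)`, `I` open: `f ∈ L²(I)` and `f` has a weak derivative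
in `L²(I)`. -/
def MemH1 (I : Set ℝ) (f : ℝ → ℂ) : Prop :=
  MemLp f 2 (volume.restrict I) ∧
    ∃ g, HasWeakDerivOn I f g ∧ MemLp g 2 (volume.restrict I)

/-- A complex function on the tadpole graph, as the couple of its component `c` on the loop,
identified with `[-L, L]`, and its component `h` on the half-line `[0, ∞)`. The components are
total functions on `ℝ`; all notions below depend only on `c` on `[-L, L]` and on `h` on
`[0, ∞)`. -/
structure TadpoleFun where
  c : ℝ → ℂ
  h : ℝ → ℂ

namespace TadpoleFun

/-- `‖v‖_{Lᵖ}^p`, the integral of `|v|^p` over the graph with loop of length `2L`. -/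
def lpNormPow (L : ℝ) (p : ℕ) (v : TadpoleFun) : ℝ :=
  (∫ x in Ioo (-L) L, ‖v.c x‖ ^ p) + ∫ x in Ioi (0 : ℝ), ‖v.h x‖ ^ p

/-- The edgewise weak derivative `v'`. -/
def wderiv (L : ℝ) (v : TadpoleFun) : TadpoleFun where
  c := weakDeriv (Ioo (-L) L) v.c
  h := weakDeriv (Ioi 0) v.h

/-- The space `H¹_D`: both components are `H¹` (as usual in one dimension represented by their
continuous representatives, up to the end points of the edges), and the values at the three
edge ends that form the vertex agree. -/
def H1D (L : ℝ) : Set TadpoleFun :=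
  {v | MemH1 (Ioo (-L) L) v.c ∧ ContinuousOn v.c (Icc (-L) L) ∧
    MemH1 (Ioi 0) v.h ∧ ContinuousOn v.h (Ici 0) ∧
    v.c L = v.c (-L) ∧ v.c (-L) = v.h 0}

/-- The value at the vertex (for functions in `H1D L` it is also `v.c L` and `v.c (-L)`). -/
def vertexValue (v : TadpoleFun) : ℂ := v.h 0

/-- `v ≡ 0` on the graph. -/
def IsZero (L : ℝ) (v : TadpoleFun) : Prop :=
  (∀ x ∈ Icc (-L) L, v.c x = 0) ∧ ∀ x ∈ Ici (0 : ℝ), v.h x = 0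

/-- The quadratic form `Q(v) = ‖v'‖²_{L²} + γ |v(vertex)|²` of the Hamiltonian with a delta
condition of strength `γ` at the vertex. -/
def quadForm (γ L : ℝ) (v : TadpoleFun) : ℝ :=
  (v.wderiv L).lpNormPow L 2 + γ * ‖v.vertexValue‖ ^ 2

/-- The action functional. -/
def action (ω γ L : ℝ) (v : TadpoleFun) : ℝ :=
  1 / 2 * v.quadForm γ L + ω / 2 * v.lpNormPow L 2 - 1 / 4 * v.lpNormPow L 4

/-- The Nehari functional. -/
def nehari (ω γ L : ℝ) (v : TadpoleFun) : ℝ :=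
  v.quadForm γ L + ω * v.lpNormPow L 2 - v.lpNormPow L 4

/-- The Nehari manifold. -/
def nehariManifold (ω γ L : ℝ) : Set TadpoleFun :=
  {v | v ∈ H1D L ∧ ¬ v.IsZero L ∧ v.nehari ω γ L = 0}

/-- The infimum of the action on the Nehari manifold. -/
def actionLevel (ω γ L : ℝ) : ℝ :=
  sInf (action ω γ L '' nehariManifold ω γ L)

end TadpoleFun

end

/-! Write E(u) = Q(u) + ω‖u‖₂² and P(u) = ‖u‖₄⁴. On the Nehari manifold E = P = 4S, and every u with
P(u) > 0 can be rescaled onto it. With T = 4s this gives T·P(u) ≤ E(u)² for all u in the form domain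
(`actionLevel_mul_quartic_le`). A minimizer is a u with E(u) = P(u) = T.

Compactness of a minimizing sequence can fail only by mass escaping along the half-line. There the
relevant constant is that of the soliton on the line: σ·P ≤ (E + √ω|f(a)|²)² on [a, ∞) with σ =
(16/3)ω^(3/2) (`IsH1Pair.quartic_Ici_le`). The hypothesis on the level says exactly T < σ.

Tightness (`exists_pos_forall_tail_energy_le`, `exists_tail_quartic_le`): cut an almost minimizer at
a point R where δ = √ω|u(R)|² is small, and continue it by an exponential, which costs exactly δ. If
t = E(u) = P(u) and r is the energy beyond R, the two inequalities above add up to T·t ≤ (t - r +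
δ)² + (T/σ)(r + δ)². For δ = 0 and r ≤ t the right side is at most t² - (1 - T/σ)·t·r. As t is close
to T and T/σ < 1, r must be small. Escape of a part and escape of the whole are excluded at once.

Strong convergence: the energy bound gives equicontinuity, hence a pointwise convergent subsequence,
which by tightness is Cauchy in L⁴. If E(uₙ - uₘ) stayed above ε, the parallelogram law would put
E(uₙ + uₘ) below 4T - ε/2, while P(uₙ + uₘ) is close to P(2uₙ) ≥ 16T; this contradicts T·P ≤ E²
(`energy_sub_cauchy`). So the sequence converges in H¹, and its limit has E = P = T.

Weak derivatives enter only through `mem_H1D_iff` and `quadForm_add`; everywhere else a derivative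
is a function of which u is a primitive. -/

open Filter Topology

/-! ### Chain rule along absolutely continuous curves -/

/-- A function whose increments are dominated by those of an absolutely continuous function is
absolutely continuous. -/
theorem AbsolutelyContinuousOnInterval.of_dist_le {X Y : Type*} [PseudoMetricSpace X]
    [PseudoMetricSpace Y] {f : ℝ → X} {h : ℝ → Y} {a b : ℝ}
    (hh : AbsolutelyContinuousOnInterval h a b)
    (hfh : ∀ x ∈ uIcc a b, ∀ y ∈ uIcc a b, dist (f x) (f y) ≤ dist (h x) (h y)) :
    AbsolutelyContinuousOnInterval f a b := by
  rw [absolutelyContinuousOnInterval_iff] at hh ⊢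
  intro ε hε
  obtain ⟨δ, hδ, H⟩ := hh ε hε
  refine ⟨δ, hδ, fun E hE hlt => lt_of_le_of_lt (Finset.sum_le_sum fun i hi => ?_) (H E hE hlt)⟩
  have := hE.1 i hi
  exact hfh _ this.1 _ this.2

/-- Fundamental theorem of calculus for a `C¹` function along a primitive. -/
theorem sub_eq_integral_fderiv_comp {E : Type*} [NormedAddCommGroup E] [NormedSpace ℝ E]
    [FiniteDimensional ℝ E] {f g : ℝ → E} {a b : ℝ} (hab : a ≤ b)
    (hg : IntervalIntegrable g volume a b)
    (hfg : ∀ x ∈ Icc a b, f x = f a + ∫ t in a..x, g t)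
    {Φ : E → ℝ} (hΦ : ContDiff ℝ 1 Φ) :
    Φ (f b) - Φ (f a) = ∫ t in a..b, fderiv ℝ Φ (f t) (g t) := by
  have := FiniteDimensional.complete ℝ E
  have hint : ∀ x ∈ Icc a b, ∀ y ∈ Icc a b, IntervalIntegrable g volume x y := fun x hx y hy =>
    hg.mono_set (by rw [uIcc_of_le hab]; exact uIcc_subset_Icc hx hy)
  have ha : a ∈ Icc a b := left_mem_Icc.2 hab
  have hsub : ∀ x ∈ Icc a b, ∀ y ∈ Icc a b, f y - f x = ∫ t in x..y, g t := by
    intro x hx y hy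
    rw [hfg x hx, hfg y hy, ← intervalIntegral.integral_add_adjacent_intervals (hint a ha x hx)
      (hint x hx y hy)]
    abel
  have hcont : ContinuousOn f (Icc a b) := by
    have : ContinuousOn (fun x => f a + ∫ t in a..x, g t) (Icc a b) := by
      have := intervalIntegral.continuousOn_primitive_interval (a := a) (b := b)
        (μ := volume) (f := g) ((intervalIntegrable_iff_integrableOn_Icc_of_le hab).1 hg |>.mono_set
          (by rw [uIcc_of_le hab]))
      rw [uIcc_of_le hab] at this
      exact continuousOn_const.add this
    exact this.congr hfg
  obtain ⟨r, hr⟩ := (isCompact_Icc.image_of_continuousOn hcont).isBounded.subset_closedBall 0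
  obtain ⟨K, hK⟩ := (hΦ.contDiffOn (s := Metric.closedBall (0 : E) r)).exists_lipschitzOnWith
    (by decide) (convex_closedBall _ _) (isCompact_closedBall _ _)
  have hmem : ∀ x ∈ Icc a b, f x ∈ Metric.closedBall (0 : E) r := fun x hx => hr ⟨x, hx, rfl⟩
  -- Φ is Lipschitz on a ball containing the compact image of f, so the increments of Φ ∘ f are
  -- dominated by those of K∫‖g‖.
  have hAC : AbsolutelyContinuousOnInterval (fun x => Φ (f x)) a b := by
    have h1 : AbsolutelyContinuousOnInterval (fun x => (K : ℝ) * ∫ t in a..x, ‖g t‖) a b :=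
      (hg.norm.absolutelyContinuousOnInterval_intervalIntegral (by simp)).const_mul _
    refine h1.of_dist_le ?_
    rw [uIcc_of_le hab]
    intro x hx y hy
    refine (hK.dist_le_mul _ (hmem x hx) _ (hmem y hy)).trans ?_
    rw [Real.dist_eq, ← mul_sub, abs_mul, NNReal.abs_eq, dist_comm, dist_eq_norm, hsub x hx y hy,
      abs_sub_comm, intervalIntegral.integral_interval_sub_left (hint a ha y hy).norm
        (hint a ha x hx).norm]
    exact mul_le_mul_of_nonneg_left (intervalIntegral.norm_integral_le_abs_integral_norm) K.2
  rw [← hAC.integral_deriv_eq_sub]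
  refine intervalIntegral.integral_congr_ae ?_
  -- f is a primitive only on [a, b], so it need not be differentiable at the end point.
  have hb : ∀ᵐ x : ℝ ∂volume, x ≠ b := by simp [ae_iff, measure_singleton]
  filter_upwards [hg.ae_hasDerivAt_integral, hb] with x hx hxb hxm
  rw [uIoc_of_le hab] at hxm
  have hxI : x ∈ Ioo a b := ⟨hxm.1, lt_of_le_of_ne hxm.2 hxb⟩
  have h1 := hx (by rw [uIcc_of_le hab]; exact Ioo_subset_Icc_self hxI) a (by simp)
  have h2 : HasDerivAt f (g x) x := by
    refine (h1.const_add (f a)).congr_of_eventuallyEq ?_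
    filter_upwards [Ioo_mem_nhds hxI.1 hxI.2] with y hy
    exact hfg y (Ioo_subset_Icc_self hy)
  exact ((hΦ.differentiable (by norm_num) (f x)).hasFDerivAt.comp_hasDerivAt x h2).deriv

/-! ### H¹ functions on an interval as primitives -/

/-- `f` and `g` are square integrable on `J` and `f` is a primitive of `g` on `J`. -/
structure IsH1Pair (J : Set ℝ) (f g : ℝ → ℂ) : Prop where
  memLp : MemLp f 2 (volume.restrict J)
  memLp_deriv : MemLp g 2 (volume.restrict J)
  sub_eq : ∀ x ∈ J, ∀ y ∈ J, x ≤ y → f y - f x = ∫ t in x..y, g t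

/-- The weighted squared `H¹` norm on `J`. -/
noncomputable def edgeEnergy (ω : ℝ) (J : Set ℝ) (f g : ℝ → ℂ) : ℝ :=
  ∫ x in J, (‖g x‖ ^ 2 + ω * ‖f x‖ ^ 2)

theorem MemLp.integrable_norm_sq {α : Type*} [MeasurableSpace α] {μ : Measure α} {f : α → ℂ}
    (h : MemLp f 2 μ) : Integrable (fun x => ‖f x‖ ^ 2) μ :=
  (memLp_two_iff_integrable_sq_norm h.1).1 h

section Primitive

variable {J : Set ℝ} [J.OrdConnected] {f g : ℝ → ℂ}

theorem intervalIntegrable_of_memLp_two (hg : MemLp g 2 (volume.restrict J)) {x y : ℝ}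
    (hx : x ∈ J) (hy : y ∈ J) : IntervalIntegrable g volume x y := by
  rw [intervalIntegrable_iff']
  have h1 : MemLp g 2 (volume.restrict (uIcc x y)) :=
    hg.mono_measure (Measure.restrict_mono (OrdConnected.uIcc_subset ‹_› hx hy) le_rfl)
  have : IsFiniteMeasure (volume.restrict (uIcc x y)) :=
    ⟨by rw [Measure.restrict_apply_univ]; exact isCompact_uIcc.measure_lt_top⟩
  exact h1.integrable (by norm_num)

/-- Uniform continuity modulus of a primitive of a square integrable function. -/
theorem norm_sub_le_of_memLp_two (hg : MemLp g 2 (volume.restrict J))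
    (hfg : ∀ x ∈ J, ∀ y ∈ J, x ≤ y → f y - f x = ∫ t in x..y, g t) {x y δ : ℝ}
    (hδ : 0 < δ) (hx : x ∈ J) (hy : y ∈ J) :
    ‖f y - f x‖ ≤ δ * (∫ t in J, ‖g t‖ ^ 2) + |y - x| / (4 * δ) := by
  wlog hxy : x ≤ y generalizing x y
  · rw [norm_sub_rev, abs_sub_comm]
    exact this hy hx (le_of_not_ge hxy)
  have hsub : Ioc x y ⊆ J := fun t ht => OrdConnected.out ‹_› hx hy ⟨ht.1.le, ht.2⟩
  have hg2 : IntegrableOn (fun t => ‖g t‖ ^ 2) J := MemLp.integrable_norm_sq hg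
  rw [hfg x hx y hy hxy]
  have h2 : IntegrableOn (fun t => δ * ‖g t‖ ^ 2) (Ioc x y) := (hg2.mono_set hsub).const_mul δ
  have h3 : IntegrableOn (fun _ : ℝ => 1 / (4 * δ)) (Ioc x y) :=
    integrableOn_const (by simp)
  calc ‖∫ t in x..y, g t‖ ≤ ∫ t in x..y, ‖g t‖ := intervalIntegral.norm_integral_le_integral_norm hxy
    _ = ∫ t in Ioc x y, ‖g t‖ := intervalIntegral.integral_of_le hxy
    _ ≤ ∫ t in Ioc x y, (δ * ‖g t‖ ^ 2 + 1 / (4 * δ)) := by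
        refine integral_mono (intervalIntegrable_of_memLp_two hg hx hy).norm.1 (h2.add h3)
          fun t => ?_
        -- Young's inequality with a free δ plays the role of Cauchy-Schwarz; optimizing in δ would
        -- give the Hölder-1/2 modulus.
        have : δ * ‖g t‖ ^ 2 + 1 / (4 * δ) - ‖g t‖ = (2 * δ * ‖g t‖ - 1) ^ 2 / (4 * δ) := by
          field_simp; ring
        have h5 : 0 ≤ (2 * δ * ‖g t‖ - 1) ^ 2 / (4 * δ) := by positivity
        change ‖g t‖ ≤ _
        linarith
    _ = δ * (∫ t in Ioc x y, ‖g t‖ ^ 2) + (y - x) / (4 * δ) := by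
        rw [integral_add h2 h3, integral_const_mul]
        simp [hxy, div_eq_mul_inv]
    _ ≤ _ := by
        rw [abs_of_nonneg (sub_nonneg.2 hxy)]
        gcongr
        exact Eventually.of_forall fun t => by positivity

theorem continuousOn_of_memLp_two (hg : MemLp g 2 (volume.restrict J))
    (hfg : ∀ x ∈ J, ∀ y ∈ J, x ≤ y → f y - f x = ∫ t in x..y, g t) : ContinuousOn f J := by
  refine UniformContinuousOn.continuousOn (Metric.uniformContinuousOn_iff.2 fun ε hε => ?_)
  set A := ∫ t in J, ‖g t‖ ^ 2
  have hA : 0 ≤ A := integral_nonneg fun t => by positivity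
  set δ := ε / (2 * (A + 1))
  have hδ : 0 < δ := by positivity
  refine ⟨2 * δ * ε, by positivity, fun x hx y hy hxy => ?_⟩
  rw [dist_comm, dist_eq_norm]
  refine (norm_sub_le_of_memLp_two hg hfg hδ hx hy).trans_lt ?_
  rw [dist_comm, Real.dist_eq] at hxy
  have h1 : δ * A < ε / 2 := by
    have : δ * (A + 1) = ε / 2 := by simp only [δ]; field_simp
    nlinarith
  have h2 : |y - x| / (4 * δ) < ε / 2 := by
    rw [div_lt_iff₀ (by positivity)]
    linarith
  linarith

end Primitive

namespace IsH1Pair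

variable {J J' : Set ℝ} {f g f' g' : ℝ → ℂ} {ω : ℝ}

theorem mono (h : IsH1Pair J f g) (hJ : J' ⊆ J) : IsH1Pair J' f g :=
  ⟨h.memLp.mono_measure (Measure.restrict_mono hJ le_rfl),
    h.memLp_deriv.mono_measure (Measure.restrict_mono hJ le_rfl),
    fun x hx y hy => h.sub_eq x (hJ hx) y (hJ hy)⟩

theorem integrable_sq (h : IsH1Pair J f g) : IntegrableOn (fun x => ‖f x‖ ^ 2) J :=
  MemLp.integrable_norm_sq h.memLp

theorem integrable_deriv_sq (h : IsH1Pair J f g) : IntegrableOn (fun x => ‖g x‖ ^ 2) J :=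
  MemLp.integrable_norm_sq h.memLp_deriv

theorem integrable_energy (h : IsH1Pair J f g) (ω : ℝ) :
    IntegrableOn (fun x => ‖g x‖ ^ 2 + ω * ‖f x‖ ^ 2) J :=
  h.integrable_deriv_sq.add (h.integrable_sq.const_mul ω)

theorem intervalIntegrable (h : IsH1Pair J f g) [J.OrdConnected] {x y : ℝ} (hx : x ∈ J)
    (hy : y ∈ J) : IntervalIntegrable g volume x y :=
  intervalIntegrable_of_memLp_two h.memLp_deriv hx hy

theorem add (h : IsH1Pair J f g) (h' : IsH1Pair J f' g') [J.OrdConnected] :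
    IsH1Pair J (fun x => f x + f' x) (fun x => g x + g' x) := by
  refine ⟨h.memLp.add h'.memLp, h.memLp_deriv.add h'.memLp_deriv, fun x hx y hy hxy => ?_⟩
  rw [intervalIntegral.integral_add (h.intervalIntegrable hx hy) (h'.intervalIntegrable hx hy),
    ← h.sub_eq x hx y hy hxy, ← h'.sub_eq x hx y hy hxy]
  ring

theorem const_mul (h : IsH1Pair J f g) (c : ℂ) :
    IsH1Pair J (fun x => c * f x) (fun x => c * g x) := by
  refine ⟨h.memLp.const_mul c, h.memLp_deriv.const_mul c, fun x hx y hy hxy => ?_⟩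
  rw [intervalIntegral.integral_const_mul, ← h.sub_eq x hx y hy hxy]
  ring

theorem sub (h : IsH1Pair J f g) (h' : IsH1Pair J f' g') [J.OrdConnected] :
    IsH1Pair J (fun x => f x - f' x) (fun x => g x - g' x) := by
  have := h.add (h'.const_mul (-1))
  simpa [← sub_eq_add_neg] using this

/-- Uniform continuity modulus in terms of the `L²` norm of the derivative. -/
theorem norm_sub_le (h : IsH1Pair J f g) [J.OrdConnected] {x y δ : ℝ}
    (hδ : 0 < δ) (hx : x ∈ J) (hy : y ∈ J) :
    ‖f y - f x‖ ≤ δ * (∫ t in J, ‖g t‖ ^ 2) + |y - x| / (4 * δ) :=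
  norm_sub_le_of_memLp_two h.memLp_deriv h.sub_eq hδ hx hy

theorem continuousOn (h : IsH1Pair J f g) [J.OrdConnected] : ContinuousOn f J :=
  continuousOn_of_memLp_two h.memLp_deriv h.sub_eq

/-- Bogomolny type estimate. -/
theorem abs_sub_le_integral (h : IsH1Pair J f g) [J.OrdConnected] {Φ W : ℂ → ℝ}
    (hΦ : ContDiff ℝ 1 Φ) (hW : Continuous W) (hΦW : ∀ z, ‖fderiv ℝ Φ z‖ ≤ 2 * W z)
    {x y : ℝ} (hx : x ∈ J) (hy : y ∈ J) (hxy : x ≤ y) :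
    |Φ (f y) - Φ (f x)| ≤ ∫ t in Icc x y, (‖g t‖ ^ 2 + W (f t) ^ 2) := by
  have hsub : Icc x y ⊆ J := OrdConnected.out ‹_› hx hy
  have hcont := h.continuousOn.mono hsub
  rw [sub_eq_integral_fderiv_comp hxy (h.intervalIntegrable hx hy) (fun t ht => by
    rw [← h.sub_eq x hx t (hsub ht) ht.1]; ring) hΦ]
  rw [← Real.norm_eq_abs, integral_Icc_eq_integral_Ioc, ← intervalIntegral.integral_of_le hxy]
  refine intervalIntegral.norm_integral_le_of_norm_le hxy (Eventually.of_forall fun t _ => ?_) ?_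
  -- |DΦ(f)g| ≤ 2W(f)|g| ≤ |g|² + W(f)².
  · have h1 := (fderiv ℝ Φ (f t)).le_opNorm (g t)
    have h2 := mul_le_mul_of_nonneg_right (hΦW (f t)) (norm_nonneg (g t))
    nlinarith [sq_nonneg (‖g t‖ - W (f t))]
  · rw [intervalIntegrable_iff_integrableOn_Icc_of_le hxy]
    exact (h.integrable_deriv_sq.mono_set hsub).add
      (((hW.comp_continuousOn hcont).pow 2).integrableOn_Icc)

/-- The Bogomolny estimate with Φ = |z|² and W = |z|. It is the source of all sup bounds by the
energy. -/
theorem abs_sq_sub_sq_le (h : IsH1Pair J f g) [J.OrdConnected]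
    {x y : ℝ} (hx : x ∈ J) (hy : y ∈ J) (hxy : x ≤ y) :
    |‖f y‖ ^ 2 - ‖f x‖ ^ 2| ≤ ∫ t in Icc x y, (‖g t‖ ^ 2 + ‖f t‖ ^ 2) := by
  refine h.abs_sub_le_integral (Φ := fun z => ‖z‖ ^ 2) (W := fun z => ‖z‖)
    (contDiff_norm_sq ℝ) continuous_norm (fun z => ?_) hx hy hxy
  rw [fderiv_norm_sq_apply]
  refine ContinuousLinearMap.opNorm_le_bound _ (by positivity) fun w => ?_
  have := abs_real_inner_le_norm z w
  rw [two_smul, Real.norm_eq_abs]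
  change |inner ℝ z w + inner ℝ z w| ≤ _
  rw [← two_mul, abs_mul, abs_two]
  linarith

end IsH1Pair

/-! ### Sup bounds, decay at infinity and quartic integrals -/

/-- The integral of `‖f‖⁴` over `J`. -/
noncomputable def quartic (J : Set ℝ) (f : ℝ → ℂ) : ℝ := ∫ x in J, ‖f x‖ ^ 4

theorem quartic_nonneg (J : Set ℝ) (f : ℝ → ℂ) : 0 ≤ quartic J f :=
  integral_nonneg fun x => by positivity

theorem edgeEnergy_nonneg {ω : ℝ} (hω : 0 ≤ ω) (J : Set ℝ) (f g : ℝ → ℂ) :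
    0 ≤ edgeEnergy ω J f g :=
  integral_nonneg fun x => by positivity

namespace IsH1Pair

variable {J : Set ℝ} {f g : ℝ → ℂ} {ω a : ℝ}

/-- The minimum of |f|² is at most its mean. This is how points where f is small are found, at
infinity and, uniformly along a sequence, in a bounded window. -/
theorem exists_mul_norm_sq_le (h : IsH1Pair J f g) [J.OrdConnected] {x ℓ : ℝ} (hℓ : 0 ≤ ℓ)
    (hx : x ∈ J) (hxℓ : x + ℓ ∈ J) :
    ∃ y ∈ Icc x (x + ℓ), ℓ * ‖f y‖ ^ 2 ≤ ∫ t in Icc x (x + ℓ), ‖f t‖ ^ 2 := by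
  have hsub : Icc x (x + ℓ) ⊆ J := OrdConnected.out ‹_› hx hxℓ
  have hc : ContinuousOn (fun t => ‖f t‖ ^ 2) (Icc x (x + ℓ)) :=
    (h.continuousOn.mono hsub).norm.pow 2
  obtain ⟨y, hy, hmin⟩ := isCompact_Icc.exists_isMinOn (nonempty_Icc.2 (by linarith)) hc
  refine ⟨y, hy, ?_⟩
  calc ℓ * ‖f y‖ ^ 2 = ∫ _ in Icc x (x + ℓ), ‖f y‖ ^ 2 := by simp [hℓ]
    _ ≤ _ := setIntegral_mono_on (integrableOn_const (by simp)) hc.integrableOn_Icc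
      measurableSet_Icc fun t ht => hmin ht

theorem exists_norm_sq_le_of_Ici (h : IsH1Pair (Ici a) f g) {ε : ℝ} (hε : 0 < ε) {x : ℝ}
    (hx : a ≤ x) : ∃ y, x ≤ y ∧ ‖f y‖ ^ 2 ≤ ε := by
  set B := ∫ t in Ici a, ‖f t‖ ^ 2
  have hB : 0 ≤ B := integral_nonneg fun t => by positivity
  have hℓ : 0 ≤ (B + 1) / ε := by positivity
  obtain ⟨y, hy, hle⟩ := h.exists_mul_norm_sq_le hℓ hx
    (show a ≤ x + (B + 1) / ε by linarith)
  refine ⟨y, hy.1, ?_⟩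
  have h1 : ∫ t in Icc x (x + (B + 1) / ε), ‖f t‖ ^ 2 ≤ B :=
    setIntegral_mono_set h.integrable_sq (Eventually.of_forall fun t => by positivity)
      (Icc_subset_Ici_self.trans (Ici_subset_Ici.2 hx)).eventuallyLE
  rw [div_mul_eq_mul_div, div_le_iff₀ hε] at hle
  have h2 : (B + 1) * ‖f y‖ ^ 2 ≤ (B + 1) * ε := by
    have : (∫ t in Icc x (x + (B + 1) / ε), ‖f t‖ ^ 2) * ε ≤ B * ε :=
      mul_le_mul_of_nonneg_right h1 hε.le
    linarith
  exact le_of_mul_le_mul_left h2 (by linarith)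

theorem norm_sq_le_of_Ici (h : IsH1Pair (Ici a) f g) {x : ℝ} (hx : a ≤ x) :
    ‖f x‖ ^ 2 ≤ ∫ t in Ici x, (‖g t‖ ^ 2 + ‖f t‖ ^ 2) := by
  refine le_of_forall_pos_le_add fun ε hε => ?_
  obtain ⟨y, hxy, hy⟩ := h.exists_norm_sq_le_of_Ici hε hx
  have h1 := abs_le.1 (h.abs_sq_sub_sq_le (show x ∈ Ici a from hx)
    (show y ∈ Ici a from hx.trans hxy) hxy)
  have h2 : ∫ t in Icc x y, (‖g t‖ ^ 2 + ‖f t‖ ^ 2) ≤ ∫ t in Ici x, (‖g t‖ ^ 2 + ‖f t‖ ^ 2) :=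
    setIntegral_mono_set ((h.integrable_deriv_sq.add h.integrable_sq).mono_set
      (Ici_subset_Ici.2 hx)) (Eventually.of_forall fun t => by positivity)
      Icc_subset_Ici_self.eventuallyLE
  linarith [h1.1]

theorem tendsto_norm_sq_atTop (h : IsH1Pair (Ici a) f g) :
    Tendsto (fun x => ‖f x‖ ^ 2) atTop (𝓝 0) := by
  have h1 : Tendsto (fun x => ∫ t in Ici x, (‖g t‖ ^ 2 + ‖f t‖ ^ 2)) atTop (𝓝 0) := by
    refine tendsto_integral_Ici_zero tendsto_id |>.congr fun x => rfl
  refine squeeze_zero' (Eventually.of_forall fun x => by positivity) ?_ h1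
  filter_upwards [eventually_ge_atTop a] with x hx using h.norm_sq_le_of_Ici hx

/-- Continuity and decay at infinity. The maximum value is the parameter m of the comparison
function in the sharp inequality below. -/
theorem exists_isMaxOn_norm_sq (h : IsH1Pair (Ici a) f g) :
    ∃ x ∈ Ici a, ∀ y ∈ Ici a, ‖f y‖ ^ 2 ≤ ‖f x‖ ^ 2 := by
  by_cases h0 : ∀ y ∈ Ici a, ‖f y‖ ^ 2 = 0
  · exact ⟨a, self_mem_Ici, fun y hy => by rw [h0 y hy, h0 a self_mem_Ici]⟩
  push Not at h0
  obtain ⟨x₀, hx₀, hne⟩ := h0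
  have hpos : 0 < ‖f x₀‖ ^ 2 := lt_of_le_of_ne (by positivity) hne.symm
  obtain ⟨x, hx, hmax⟩ := (h.continuousOn.norm.pow 2).exists_isMaxOn' isClosed_Ici hx₀ (by
    have h1 : ∀ᶠ y in atTop, ‖f y‖ ^ 2 ≤ ‖f x₀‖ ^ 2 :=
      h.tendsto_norm_sq_atTop.eventually (eventually_le_nhds hpos)
    obtain ⟨X, hX⟩ := eventually_atTop.1 h1
    rw [eventually_inf_principal]
    have h2 : (Icc a X)ᶜ ∈ cocompact ℝ := isCompact_Icc.compl_mem_cocompact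
    filter_upwards [h2] with y hy hya
    refine hX y ?_
    by_contra hlt
    exact hy ⟨hya, (not_le.1 hlt).le⟩)
  exact ⟨x, hx, fun y hy => hmax hy⟩

theorem integrable_quartic (h : IsH1Pair J f g) (hJ : MeasurableSet J) {B : ℝ}
    (hB : ∀ x ∈ J, ‖f x‖ ^ 2 ≤ B) : IntegrableOn (fun x => ‖f x‖ ^ 4) J := by
  refine (h.integrable_sq.const_mul B).mono' (h.memLp.1.norm.pow 4) ?_
  refine (ae_restrict_iff' hJ).2 (Eventually.of_forall fun x hx => ?_)
  rw [Real.norm_of_nonneg (by positivity)]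
  nlinarith [hB x hx, sq_nonneg ‖f x‖]

theorem quartic_le (h : IsH1Pair J f g) (hJ : MeasurableSet J) {B : ℝ}
    (hB : ∀ x ∈ J, ‖f x‖ ^ 2 ≤ B) : quartic J f ≤ B * ∫ x in J, ‖f x‖ ^ 2 := by
  rw [quartic, ← integral_const_mul]
  refine setIntegral_mono_on (h.integrable_quartic hJ hB) (h.integrable_sq.const_mul B) hJ
    fun x hx => ?_
  nlinarith [hB x hx, sq_nonneg ‖f x‖]

end IsH1Pair

/-! ### Sharp Gagliardo-Nirenberg inequality on a half-line -/

/-- The exponent 3/2 exceeds 1, so the real power is C¹ also where its base vanishes. For a negative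
base it is zero, because cos(3π/2) = 0, so no restriction to |z|² ≤ m is needed. -/
theorem contDiff_one_sub_norm_sq_rpow (m : ℝ) (c : ℝ) :
    ContDiff ℝ 1 (fun z : ℂ => c * (1 - ‖z‖ ^ 2 / m) ^ (3 / 2 : ℝ)) := by
  have h1 : ContDiff ℝ 1 fun x : ℝ => x ^ (3 / 2 : ℝ) := by
    have := Real.contDiff_rpow_const_of_le (p := 3 / 2) (n := 1) (by norm_num)
    simpa using this
  exact contDiff_const.mul (h1.comp (contDiff_const.sub ((contDiff_norm_sq ℝ).div_const m)))

theorem norm_fderiv_one_sub_norm_sq_rpow_le {m c : ℝ} (hm : 0 < m) (hc : 0 ≤ c) (z : ℂ) :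
    ‖fderiv ℝ (fun z : ℂ => c * (1 - ‖z‖ ^ 2 / m) ^ (3 / 2 : ℝ)) z‖
      ≤ 3 * c / m * (‖z‖ * √(1 - ‖z‖ ^ 2 / m)) := by
  have h0 : HasFDerivAt (fun z : ℂ => ‖z‖ ^ 2) (2 • innerSL ℝ z) z := by
    have := ((contDiff_norm_sq ℝ (n := 1)).differentiable (by norm_num) z).hasFDerivAt (𝕜 := ℝ)
      (E := ℂ)
    rwa [fderiv_norm_sq_apply] at this
  have h1 : HasFDerivAt (fun z : ℂ => 1 - ‖z‖ ^ 2 / m) (-(m⁻¹ • (2 • innerSL ℝ z))) z := by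
    have := (h0.const_mul m⁻¹).const_sub 1
    simpa [div_eq_inv_mul] using this
  have h2 := (Real.hasDerivAt_rpow_const (x := 1 - ‖z‖ ^ 2 / m) (p := 3 / 2)
    (Or.inr (by norm_num))).comp_hasFDerivAt z h1
  have h3 := h2.const_mul c
  have h4 : (fun z : ℂ => c * (1 - ‖z‖ ^ 2 / m) ^ (3 / 2 : ℝ)) =
    fun y => c * ((fun x : ℝ => x ^ (3 / 2 : ℝ)) ∘ fun z : ℂ => 1 - ‖z‖ ^ 2 / m) y := rfl
  rw [h4, h3.fderiv, show (3 / 2 : ℝ) - 1 = 1 / 2 by norm_num, ← Real.sqrt_eq_rpow]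
  refine ContinuousLinearMap.opNorm_le_bound _ (by positivity) fun w => ?_
  have h5 := abs_real_inner_le_norm z w
  have h6 : (c • (3 / 2 * √(1 - ‖z‖ ^ 2 / m)) • -(m⁻¹ • (2 • innerSL ℝ z))) w =
      -(3 * c / m * √(1 - ‖z‖ ^ 2 / m)) * inner ℝ z w := by
    rw [two_smul]
    change c * (3 / 2 * √(1 - ‖z‖ ^ 2 / m) * -(m⁻¹ * (inner ℝ z w + inner ℝ z w))) = _
    field_simp
    ring
  rw [h6, Real.norm_eq_abs, abs_mul, abs_neg, abs_of_nonneg (by positivity)]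
  have h7 : 0 ≤ 3 * c / m * √(1 - ‖z‖ ^ 2 / m) := by positivity
  calc _ ≤ 3 * c / m * √(1 - ‖z‖ ^ 2 / m) * (‖z‖ * ‖w‖) := mul_le_mul_of_nonneg_left h5 h7
    _ = _ := by ring

theorem one_sub_mul_le_rpow {q : ℝ} (hq : q ≤ 1) : 1 - 3 / 2 * q ≤ (1 - q) ^ (3 / 2 : ℝ) := by
  have := one_add_mul_self_le_rpow_one_add (s := -q) (by linarith) (p := 3 / 2) (by norm_num)
  calc 1 - 3 / 2 * q = 1 + 3 / 2 * (-q) := by ring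
    _ ≤ _ := this
    _ = _ := by rw [← sub_eq_add_neg]

/-- Sharp Gagliardo-Nirenberg inequality on a half-line, with a boundary correction which turns it
into the inequality on the line. -/
theorem IsH1Pair.quartic_Ici_le {a ω : ℝ} {f g : ℝ → ℂ} (h : IsH1Pair (Ici a) f g) (hω : 0 < ω) :
    16 / 3 * √ω ^ 3 * quartic (Ici a) f ≤ (edgeEnergy ω (Ici a) f g + √ω * ‖f a‖ ^ 2) ^ 2 := by
  obtain ⟨x₀, hx₀, hmax⟩ := h.exists_isMaxOn_norm_sq
  set m := ‖f x₀‖ ^ 2 with hm_def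
  set s := √ω with hs_def
  have hs : 0 < s := Real.sqrt_pos.2 hω
  have hsω : s ^ 2 = ω := Real.sq_sqrt hω.le
  have hP := h.quartic_le measurableSet_Ici hmax
  rcases (show 0 ≤ m by positivity).eq_or_lt with hm | hm
  · rw [← hm, zero_mul] at hP
    rw [le_antisymm hP (quartic_nonneg _ _)]
    nlinarith [sq_nonneg (edgeEnergy ω (Ici a) f g + s * ‖f a‖ ^ 2)]
  have hint4 := h.integrable_quartic measurableSet_Ici hmax
  -- W² = ω|z|² - (ω/m)|z|⁴ on |z|² ≤ m, so that |g|² + W(f)² integrates to E - (ω/m)P. Φ is a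
  -- radial potential with |∇Φ| = 2W, vanishing on |z|² = m.
  set Φ : ℂ → ℝ := fun z => (2 * s / 3 * m) * (1 - ‖z‖ ^ 2 / m) ^ (3 / 2 : ℝ) with hΦ
  set W : ℂ → ℝ := fun z => s * (‖z‖ * √(1 - ‖z‖ ^ 2 / m)) with hW
  have hWc : Continuous W := by fun_prop
  have hΦW : ∀ z, ‖fderiv ℝ Φ z‖ ≤ 2 * W z := fun z => by
    refine (norm_fderiv_one_sub_norm_sq_rpow_le hm (by positivity) z).trans_eq ?_
    simp only [hW]
    field_simp
  have hB : ∀ x y, a ≤ x → x ≤ y → |Φ (f y) - Φ (f x)| ≤ ∫ t in Icc x y, (‖g t‖ ^ 2 + W (f t) ^ 2) :=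
    fun x y hx hxy => h.abs_sub_le_integral (contDiff_one_sub_norm_sq_rpow m _) hWc hΦW
      (show x ∈ Ici a from hx) (show y ∈ Ici a from hx.trans hxy) hxy
  have hWf : ∀ t ∈ Ici a, ‖g t‖ ^ 2 + W (f t) ^ 2 =
      (‖g t‖ ^ 2 + ω * ‖f t‖ ^ 2) - ω / m * ‖f t‖ ^ 4 := by
    intro t ht
    have : 0 ≤ 1 - ‖f t‖ ^ 2 / m := by
      rw [sub_nonneg, div_le_one hm]; exact hmax t ht
    simp only [hW]
    rw [mul_pow, mul_pow, Real.sq_sqrt this, hsω]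
    field_simp
    ring
  have hintW : IntegrableOn (fun t => ‖g t‖ ^ 2 + W (f t) ^ 2) (Ici a) :=
    ((h.integrable_energy ω).sub (hint4.const_mul (ω / m))).congr
      ((ae_restrict_iff' measurableSet_Ici).2 (Eventually.of_forall fun t ht => (hWf t ht).symm))
  have htot : ∫ t in Ici a, (‖g t‖ ^ 2 + W (f t) ^ 2) =
      edgeEnergy ω (Ici a) f g - ω / m * quartic (Ici a) f := by
    rw [setIntegral_congr_fun measurableSet_Ici hWf,
      integral_sub (h.integrable_energy ω) (hint4.const_mul _), integral_const_mul]
    rfl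
  -- Bernoulli's inequality (1 - q)^(3/2) ≥ 1 - (3/2)q with q = |f(y)|²/m.
  have hΦle : ∀ y ∈ Ici a, 2 * s / 3 * m - s * ‖f y‖ ^ 2 ≤ Φ (f y) := by
    intro y hy
    have h1 := one_sub_mul_le_rpow (q := ‖f y‖ ^ 2 / m) (by rw [div_le_one hm]; exact hmax y hy)
    have h2 := mul_le_mul_of_nonneg_left h1 (show 0 ≤ 2 * s / 3 * m by positivity)
    refine le_trans (le_of_eq ?_) h2
    field_simp
  have hΦ0 : Φ (f x₀) = 0 := by
    simp only [hΦ]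
    rw [← hm_def, div_self hm.ne', sub_self, Real.zero_rpow (by norm_num), mul_zero]
  -- Φ(f) travels from Φ(f(a)) down to 0 at the maximum point x₀, then back up to nearly 2sm/3 at a
  -- far point y where f is small. Both variations are paid for by the integral.
  have hlow : 4 / 3 * s * m - s * ‖f a‖ ^ 2 ≤
      edgeEnergy ω (Ici a) f g - ω / m * quartic (Ici a) f := by
    rw [← htot]
    refine le_of_forall_pos_le_add fun ε hε => ?_
    obtain ⟨y, hxy, hy⟩ := h.exists_norm_sq_le_of_Ici (div_pos hε hs) (x := x₀) hx₀
    rw [le_div_iff₀ hs] at hy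
    have h1 := hB a x₀ le_rfl hx₀
    have h2 := hB x₀ y hx₀ hxy
    rw [hΦ0] at h1 h2
    have h3 := hΦle a self_mem_Ici
    have h4 := hΦle y (le_trans hx₀ hxy)
    have h5 : (∫ t in Icc a x₀, (‖g t‖ ^ 2 + W (f t) ^ 2)) +
        (∫ t in Icc x₀ y, (‖g t‖ ^ 2 + W (f t) ^ 2)) ≤ ∫ t in Ici a, (‖g t‖ ^ 2 + W (f t) ^ 2) := by
      rw [integral_Icc_eq_integral_Ico, ← setIntegral_union
        (by rw [Set.disjoint_left]; exact fun t h1 h2 => absurd h1.2 (not_lt.2 h2.1))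
        measurableSet_Icc (hintW.mono_set Ico_subset_Ici_self)
        (hintW.mono_set (Icc_subset_Ici_self.trans (Ici_subset_Ici.2 hx₀)))]
      exact setIntegral_mono_set hintW (Eventually.of_forall fun t => by positivity)
        (union_subset Ico_subset_Ici_self
          (Icc_subset_Ici_self.trans (Ici_subset_Ici.2 hx₀))).eventuallyLE
    have h6 := (abs_le.1 h1).1
    have h7 := (abs_le.1 h2).2
    linarith
  set E := edgeEnergy ω (Ici a) f g
  set P := quartic (Ici a) f
  have h8 : s ^ 2 * P ≤ m * (E + s * ‖f a‖ ^ 2 - 4 / 3 * s * m) := by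
    have h9 : ω / m * P ≤ E + s * ‖f a‖ ^ 2 - 4 / 3 * s * m := by linarith
    rw [div_mul_eq_mul_div, div_le_iff₀ hm] at h9
    rw [hsω]
    linarith
  have h10 := mul_le_mul_of_nonneg_left h8 hs.le
  -- With X = E + s|f(a)|², the quadratic mX - (4/3)sm² is at most 3X²/(16s), attained at m =
  -- 3X/(8s). This removes the dependence on m.
  nlinarith [sq_nonneg (3 * (E + s * ‖f a‖ ^ 2) - 8 * s * m)]

/-! ### Weak derivatives versus primitives -/

theorem exists_subset_Ioo_of_isCompact {I K : Set ℝ} (hI : IsOpen I) [I.OrdConnected]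
    (hK : IsCompact K) (hne : K.Nonempty) (hKI : K ⊆ I) :
    ∃ a ∈ I, ∃ b ∈ I, a < b ∧ K ⊆ Ioo a b := by
  obtain ⟨p, hp, hpmin⟩ := hK.exists_isLeast hne
  obtain ⟨q, hq, hqmax⟩ := hK.exists_isGreatest hne
  obtain ⟨ε, hε, h1⟩ := Metric.isOpen_iff.1 hI p (hKI hp)
  obtain ⟨δ, hδ, h2⟩ := Metric.isOpen_iff.1 hI q (hKI hq)
  refine ⟨p - ε / 2, h1 ?_, q + δ / 2, h2 ?_, ?_, fun x hx => ⟨?_, ?_⟩⟩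
  · rw [Metric.mem_ball, Real.dist_eq, abs_lt]; constructor <;> linarith
  · rw [Metric.mem_ball, Real.dist_eq, abs_lt]; constructor <;> linarith
  · linarith [hpmin hq]
  · linarith [hpmin hx]
  · linarith [hqmax hx]

theorem MeasureTheory.LocallyIntegrableOn.integrableOn_smul_of_tsupport_subset {I : Set ℝ}
    {φ : ℝ → ℝ} {w : ℝ → ℂ} (hw : LocallyIntegrableOn w I) (hφ : Continuous φ)
    (hc : HasCompactSupport φ) (hs : tsupport φ ⊆ I) : IntegrableOn (fun x => φ x • w x) I := by
  have hK : IntegrableOn (fun x => φ x • w x) (tsupport φ) :=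
    (hw.integrableOn_compact_subset hs hc.isCompact).continuousOn_smul
      hφ.continuousOn hc.isCompact
  refine ((integrableOn_iff_integrable_of_support_subset fun x hx => ?_).1 hK).integrableOn
  refine subset_tsupport φ fun h0 => hx ?_
  simp [show φ x = 0 from h0]

theorem locallyIntegrableOn_of_memLp_two {I : Set ℝ} (hI : IsOpen I) {f : ℝ → ℂ}
    (hf : MemLp f 2 (volume.restrict I)) : LocallyIntegrableOn f I := by
  refine (locallyIntegrableOn_iff hI.isLocallyClosed).2 fun K hKI hK => ?_
  have : IsFiniteMeasure (volume.restrict K) :=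
    ⟨by rw [Measure.restrict_apply_univ]; exact hK.measure_lt_top⟩
  exact (hf.mono_measure (Measure.restrict_mono hKI le_rfl)).integrable (by norm_num)

/-- Integration by parts of a primitive against a test function. -/
theorem integral_deriv_smul_eq_neg {I : Set ℝ} (hI : IsOpen I) [I.OrdConnected] {f g : ℝ → ℂ}
    (hg : LocallyIntegrableOn g I)
    (hfg : ∀ x ∈ I, ∀ y ∈ I, x ≤ y → f y - f x = ∫ t in x..y, g t) {φ : ℝ → ℝ}
    (hφ : ContDiff ℝ (⊤ : ℕ∞) φ) (hc : HasCompactSupport φ) (hs : tsupport φ ⊆ I) :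
    ∫ x in I, deriv φ x • f x = -∫ x in I, φ x • g x := by
  rcases (tsupport φ).eq_empty_or_nonempty with he | hne
  · have : φ = 0 := tsupport_eq_empty_iff.1 he
    simp [this]
  obtain ⟨a, ha, b, hb, hab, hsub⟩ := exists_subset_Ioo_of_isCompact hI hc.isCompact hne hs
  have hIcc : Icc a b ⊆ I := OrdConnected.out ‹_› ha hb
  have hIoc : Ioc a b ⊆ I := Ioc_subset_Icc_self.trans hIcc
  have hφ0 : ∀ x, x ∉ Ioo a b → φ x = 0 := fun x hx =>
    image_eq_zero_of_notMem_tsupport fun h => hx (hsub h)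
  have hdφ0 : ∀ x, x ∉ Ioo a b → deriv φ x = 0 := fun x hx =>
    image_eq_zero_of_notMem_tsupport fun h => hx (hsub (tsupport_deriv_subset h))
  have hgi : IntegrableOn g (Icc a b) := hg.integrableOn_compact_subset hIcc isCompact_Icc
  have hgI : IntervalIntegrable g volume a b :=
    (intervalIntegrable_iff_integrableOn_Icc_of_le hab.le).2 hgi
  have hprim : ∀ x ∈ Icc a b, f x = f a + ∫ t in a..x, g t := fun x hx => by
    rw [← hfg a ha x (hIcc hx) hx.1]; ring
  have hfc : ContinuousOn f (Icc a b) := by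
    have h1 := intervalIntegral.continuousOn_primitive_interval (a := a) (b := b)
        (μ := volume) (f := g) (by rwa [uIcc_of_le hab.le])
    rw [uIcc_of_le hab.le] at h1
    exact (continuousOn_const.add h1).congr hprim
  have hφ1 : ContDiff ℝ 1 φ := hφ.of_le (by exact_mod_cast le_top)
  have hdc : Continuous (deriv φ) := hφ1.continuous_deriv le_rfl
  have e1 : ∫ x in I, deriv φ x • f x = ∫ x in a..b, deriv φ x • f x := by
    rw [intervalIntegral.integral_of_le hab.le]
    refine setIntegral_eq_of_subset_of_forall_sdiff_eq_zero hI.measurableSet hIoc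
      fun x hx => ?_
    rw [hdφ0 x fun h => hx.2 (Ioo_subset_Ioc_self h), zero_smul]
  have e2 : ∫ x in I, φ x • g x = ∫ x in a..b, φ x • g x := by
    rw [intervalIntegral.integral_of_le hab.le]
    refine setIntegral_eq_of_subset_of_forall_sdiff_eq_zero hI.measurableSet hIoc
      fun x hx => ?_
    rw [hφ0 x fun h => hx.2 (Ioo_subset_Ioc_self h), zero_smul]
  have i1 : IntervalIntegrable (fun x => deriv φ x • f x) volume a b := by
    refine ContinuousOn.intervalIntegrable ?_
    rw [uIcc_of_le hab.le]
    exact hdc.continuousOn.smul hfc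
  have i2 : IntervalIntegrable (fun x => φ x • g x) volume a b :=
    hgI.continuousOn_smul hφ.continuous.continuousOn
  rw [e1, e2, eq_neg_iff_add_eq_zero, ← intervalIntegral.integral_add i1 i2]
  -- The product rule for φ·f is the chain rule for the curve t ↦ (t, f t) and Φ(t, z) = φ(t)ℓ(z). Φ
  -- has to be real valued, so the real and imaginary parts are treated separately.
  have key : ∀ ℓ : ℂ →L[ℝ] ℝ, ℓ (∫ x in a..b, (deriv φ x • f x + φ x • g x)) = 0 := by
    intro ℓ
    rw [← ℓ.intervalIntegral_comp_comm (i1.add i2)]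
    have hΦ : ContDiff ℝ 1 fun p : ℝ × ℂ => φ p.1 * ℓ p.2 :=
      (hφ1.comp contDiff_fst).mul (ℓ.contDiff.comp contDiff_snd)
    have h1 := sub_eq_integral_fderiv_comp (f := fun t => ((t, f t) : ℝ × ℂ))
      (g := fun t => ((1, g t) : ℝ × ℂ)) hab.le
      (by
        rw [intervalIntegrable_iff_integrableOn_Ioc_of_le hab.le] at hgI ⊢
        exact Integrable.prodMk (integrableOn_const (by simp)) hgI)
      (fun x hx => by
        have hgx : IntervalIntegrable g volume a x := hgI.mono_set (by
          rw [uIcc_of_le hab.le, uIcc_of_le hx.1]; exact Icc_subset_Icc_right hx.2)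
        have i3 : IntervalIntegrable (fun t => ((1, g t) : ℝ × ℂ)) volume a x := by
          rw [intervalIntegrable_iff_integrableOn_Ioc_of_le hx.1] at hgx ⊢
          exact Integrable.prodMk (integrableOn_const (by simp)) hgx
        refine Prod.ext ?_ ?_
        · have := (ContinuousLinearMap.fst ℝ ℝ ℂ).intervalIntegral_comp_comm i3
          simp only [ContinuousLinearMap.coe_fst'] at this
          simp [← this]
        · have := (ContinuousLinearMap.snd ℝ ℝ ℂ).intervalIntegral_comp_comm i3
          simp only [ContinuousLinearMap.coe_snd'] at this
          simp [← this, hprim x hx]) hΦ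
    have h2 : ∀ t, fderiv ℝ (fun p : ℝ × ℂ => φ p.1 * ℓ p.2) (t, f t) (1, g t) =
        ℓ (deriv φ t • f t + φ t • g t) := by
      intro t
      have d1 : HasFDerivAt (fun p : ℝ × ℂ => φ p.1)
          ((ContinuousLinearMap.toSpanSingleton ℝ (deriv φ t)).comp
            (ContinuousLinearMap.fst ℝ ℝ ℂ)) (t, f t) :=
        HasFDerivAt.comp (t, f t) (g := φ)
          (hφ1.differentiable (by norm_num) t).hasDerivAt.hasFDerivAt hasFDerivAt_fst
      have d2 : HasFDerivAt (fun p : ℝ × ℂ => ℓ p.2) (ℓ.comp (ContinuousLinearMap.snd ℝ ℝ ℂ))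
          (t, f t) := (ℓ.comp (ContinuousLinearMap.snd ℝ ℝ ℂ)).hasFDerivAt
      rw [show (fun p : ℝ × ℂ => φ p.1 * ℓ p.2) = (fun p => φ p.1) * fun p => ℓ p.2 from rfl,
        (d1.mul d2).fderiv, map_add, map_smul, map_smul]
      simp
      ring
    simp only [h2] at h1
    rw [← h1, hφ0 b (by simp), hφ0 a (by simp)]
    simp
  refine Complex.ext ?_ ?_
  · simpa using key Complex.reCLM
  · simpa using key Complex.imCLM

/-- The du Bois-Reymond lemma. -/
theorem exists_ae_eq_const_of_integral_deriv_smul_eq_zero {I : Set ℝ} (hI : IsOpen I)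
    [I.OrdConnected] {w : ℝ → ℂ} (hw : LocallyIntegrableOn w I)
    (h : ∀ φ : ℝ → ℝ, ContDiff ℝ (⊤ : ℕ∞) φ → HasCompactSupport φ → tsupport φ ⊆ I →
      ∫ x in I, deriv φ x • w x = 0) :
    ∃ c, ∀ᵐ x ∂volume, x ∈ I → w x = c := by
  rcases I.eq_empty_or_nonempty with rfl | ⟨x₀, hx₀⟩
  · exact ⟨0, by simp⟩
  obtain ⟨r, hr, hball⟩ := Metric.nhds_basis_closedBall.mem_iff.1 (hI.mem_nhds hx₀)
  set B : ContDiffBump x₀ := ⟨r / 2, r, by positivity, by linarith⟩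
  set ψ : ℝ → ℝ := B.normed volume with hψ
  have hψs : ContDiff ℝ (⊤ : ℕ∞) ψ := B.contDiff_normed
  have hψc : HasCompactSupport ψ := B.hasCompactSupport_normed
  have hψt : tsupport ψ ⊆ I := by rw [hψ, B.tsupport_normed_eq]; exact hball
  have hψ1 : ∫ x, ψ x = 1 := B.integral_normed
  have hψne : (tsupport ψ).Nonempty := by
    rw [hψ, B.tsupport_normed_eq]; exact Metric.nonempty_closedBall.2 hr.le
  refine ⟨∫ x in I, ψ x • w x, ?_⟩
  set c := ∫ x in I, ψ x • w x with hc_def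
  have hconst : LocallyIntegrableOn (fun _ : ℝ => c) I :=
    continuousOn_const.locallyIntegrableOn hI.measurableSet
  have key : ∀ᵐ x ∂volume, x ∈ I → w x - c = 0 := by
    refine hI.ae_eq_zero_of_integral_contDiff_smul_eq_zero (hw.sub hconst)
      fun φ hφ hc hs => ?_
    have hφi : Integrable φ := hφ.continuous.integrable_of_hasCompactSupport hc
    have hψi : Integrable ψ := hψs.continuous.integrable_of_hasCompactSupport hψc
    obtain ⟨a, ha, b, hb, hab, hsub⟩ := exists_subset_Ioo_of_isCompact hI
      (hc.isCompact.union hψc.isCompact) (hψne.inr) (union_subset hs hψt)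
    have hIcc : Icc a b ⊆ I := OrdConnected.out ‹_› ha hb
    set A := ∫ x, φ x
    -- Subtracting a multiple of the unit-mass bump ψ makes the mean zero, so that the primitive Ψ
    -- of χ is again a test function.
    set χ : ℝ → ℝ := fun x => φ x - A * ψ x with hχ
    have hχs : ContDiff ℝ (⊤ : ℕ∞) χ := hφ.sub (contDiff_const.mul hψs)
    have hχ0 : ∀ x, x ∉ Ioo a b → χ x = 0 := fun x hx => by
      have h1 : φ x = 0 := image_eq_zero_of_notMem_tsupport fun h => hx (hsub (Or.inl h))
      have h2 : ψ x = 0 := image_eq_zero_of_notMem_tsupport fun h => hx (hsub (Or.inr h))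
      simp [hχ, h1, h2]
    have hχint : ∫ x, χ x = 0 := by
      rw [integral_sub hφi (hψi.const_mul A), integral_const_mul, hψ1]; simp [A]
    set Ψ : ℝ → ℝ := fun x => ∫ t in a..x, χ t with hΨ
    have hder : ∀ x, HasDerivAt Ψ (χ x) x := fun x =>
      intervalIntegral.integral_hasDerivAt_right (hχs.continuous.intervalIntegrable _ _)
        (hχs.continuous.stronglyMeasurableAtFilter _ _) hχs.continuous.continuousAt
    have hderiv : deriv Ψ = χ := funext fun x => (hder x).deriv
    have hΨs : ContDiff ℝ (⊤ : ℕ∞) Ψ :=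
      contDiff_infty_iff_deriv.2 ⟨fun x => (hder x).differentiableAt, by rw [hderiv]; exact hχs⟩
    have hΨ0 : ∀ x, x ∉ Icc a b → Ψ x = 0 := by
      intro x hx
      rcases lt_or_ge x a with hxa | hxa
      · simp only [hΨ]
        rw [intervalIntegral.integral_symm, intervalIntegral.integral_congr (g := fun _ => 0)]
        · simp
        · intro t ht
          rw [uIcc_of_le hxa.le] at ht
          exact hχ0 t fun h => absurd ht.2 (not_le.2 h.1)
      · have hxb : b < x := by
          by_contra hle
          exact hx ⟨hxa, not_lt.1 hle⟩
        simp only [hΨ]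
        rw [intervalIntegral.integral_eq_integral_of_support_subset, hχint]
        intro t ht
        by_contra hmem
        exact ht (hχ0 t fun h => hmem ⟨h.1, h.2.le.trans hxb.le⟩)
    have hΨc : HasCompactSupport Ψ := HasCompactSupport.intro isCompact_Icc hΨ0
    have hΨt : tsupport Ψ ⊆ I := by
      refine (closure_minimal (fun x hx => ?_) isClosed_Icc).trans hIcc
      by_contra hmem
      exact hx (hΨ0 x hmem)
    have h0 := h Ψ hΨs hΨc hΨt
    have iφ := hw.integrableOn_smul_of_tsupport_subset hφ.continuous hc hs
    have iψ := hw.integrableOn_smul_of_tsupport_subset hψs.continuous hψc hψt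
    have h1 : (∫ x in I, φ x • w x) - A • c = 0 := by
      have iAψ : IntegrableOn (fun x => A • ψ x • w x) I := iψ.smul A
      rw [hc_def, ← integral_smul, ← integral_sub iφ iAψ, ← h0, hderiv]
      refine integral_congr_ae (Eventually.of_forall fun x => ?_)
      simp only [hχ, sub_smul, mul_smul]
    have h2 : ∫ x, φ x • (w x - c) = ∫ x in I, φ x • (w x - c) := by
      refine (setIntegral_eq_integral_of_forall_compl_eq_zero fun x hx => ?_).symm
      rw [image_eq_zero_of_notMem_tsupport fun h => hx (hs h), zero_smul]
    have h3 : ∫ x in I, φ x • c = A • c := by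
      rw [integral_smul_const]
      congr 1
      exact setIntegral_eq_integral_of_forall_compl_eq_zero fun x hx =>
        image_eq_zero_of_notMem_tsupport fun h => hx (hs h)
    change ∫ x, φ x • (w x - c) = 0
    rw [h2]
    simp only [smul_sub]
    rw [integral_sub iφ (hconst.integrableOn_smul_of_tsupport_subset hφ.continuous hc hs), h3, h1]
  filter_upwards [key] with x hx hxI using sub_eq_zero.1 (hx hxI)

theorem IsH1Pair.hasWeakDerivOn {I J : Set ℝ} (hI : IsOpen I) [I.OrdConnected] (hIJ : I ⊆ J)
    {f g : ℝ → ℂ} (h : IsH1Pair J f g) : HasWeakDerivOn I f g := by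
  have h' := h.mono hIJ
  have hg := locallyIntegrableOn_of_memLp_two hI h'.memLp_deriv
  exact ⟨locallyIntegrableOn_of_memLp_two hI h'.memLp, hg,
    fun φ hφ hc hs => integral_deriv_smul_eq_neg hI hg h'.sub_eq hφ hc hs⟩

/-- The difference of f and a primitive of g has zero weak derivative, hence is a.e. constant on I.
Continuity upgrades this to every point of J, including the end points that form the vertex. -/
theorem HasWeakDerivOn.isH1Pair {I J : Set ℝ} (hI : IsOpen I) [I.OrdConnected] [J.OrdConnected]
    (hne : I.Nonempty) (hIJ : I ⊆ J) (hJI : J ⊆ closure I) (hae : J =ᵐ[volume] I) {f g : ℝ → ℂ}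
    (h : HasWeakDerivOn I f g) (hf : MemLp f 2 (volume.restrict I))
    (hg : MemLp g 2 (volume.restrict I)) (hfc : ContinuousOn f J) : IsH1Pair J f g := by
  have hres : volume.restrict J = volume.restrict I := Measure.restrict_congr_set hae
  obtain ⟨x₀, hx₀⟩ := hne
  have hgJ : MemLp g 2 (volume.restrict J) := by rwa [hres]
  have hint : ∀ x ∈ J, ∀ y ∈ J, IntervalIntegrable g volume x y := fun x hx y hy =>
    intervalIntegrable_of_memLp_two hgJ hx hy
  set F : ℝ → ℂ := fun x => ∫ t in x₀..x, g t with hF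
  have hFsub : ∀ x ∈ J, ∀ y ∈ J, x ≤ y → F y - F x = ∫ t in x..y, g t := fun x hx y hy _ =>
    intervalIntegral.integral_interval_sub_left (hint _ (hIJ hx₀) _ hy) (hint _ (hIJ hx₀) _ hx)
  have hFc : ContinuousOn F J := continuousOn_of_memLp_two hgJ hFsub
  have hFl : LocallyIntegrableOn F I :=
    (hFc.mono hIJ).locallyIntegrableOn hI.measurableSet
  obtain ⟨c, hc⟩ := exists_ae_eq_const_of_integral_deriv_smul_eq_zero hI (h.1.sub hFl)
    fun φ hφ hφc hs => by
      have hdφ : Continuous (deriv φ) :=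
        (hφ.of_le (by exact_mod_cast le_top) : ContDiff ℝ 1 φ).continuous_deriv le_rfl
      have hds : tsupport (deriv φ) ⊆ I := tsupport_deriv_subset.trans hs
      have h1 := h.2.2 φ hφ hφc hs
      have h2 := integral_deriv_smul_eq_neg hI h.2.1
        (fun x hx y hy => hFsub x (hIJ hx) y (hIJ hy)) hφ hφc hs
      simp only [Pi.sub_apply, smul_sub]
      rw [integral_sub (h.1.integrableOn_smul_of_tsupport_subset hdφ hφc.deriv hds)
        (hFl.integrableOn_smul_of_tsupport_subset hdφ hφc.deriv hds), h1, h2, sub_self]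
  have hwc : ContinuousOn (f - F) J := hfc.sub hFc
  have heqI : EqOn (f - F) (fun _ => c) I :=
    Measure.eqOn_open_of_ae_eq ((ae_restrict_iff' hI.measurableSet).2 hc) hI (hwc.mono hIJ)
      continuousOn_const
  have heqJ : EqOn (f - F) (fun _ => c) J :=
    heqI.of_subset_closure hwc continuousOn_const hIJ hJI
  refine ⟨by rwa [hres], hgJ, fun x hx y hy hxy => ?_⟩
  have h1 : f x - F x = c := heqJ hx
  have h2 : f y - F y = c := heqJ hy
  rw [← hFsub x hx y hy hxy, ← sub_eq_zero]
  linear_combination h2 - h1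

/-! ### Energy and quartic integral of sums on an edge -/

section Inequalities

/-- The free parameter keeps the factor of the main term arbitrarily close to 1, at the price of a
large factor on a term that tends to zero. -/
theorem add_sq_le_of_pos {t : ℝ} (ht : 0 < t) (x y : ℝ) :
    (x + y) ^ 2 ≤ (1 + t) * x ^ 2 + (1 + 1 / t) * y ^ 2 := by
  have h : (1 + t) * x ^ 2 + (1 + 1 / t) * y ^ 2 - (x + y) ^ 2 = (t * x - y) ^ 2 / t := by
    field_simp; ring
  have : 0 ≤ (t * x - y) ^ 2 / t := by positivity
  linarith

theorem norm_add_sq_le_of_pos {t : ℝ} (ht : 0 < t) (a b : ℂ) :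
    ‖a + b‖ ^ 2 ≤ (1 + t) * ‖a‖ ^ 2 + (1 + 1 / t) * ‖b‖ ^ 2 :=
  (pow_le_pow_left₀ (norm_nonneg _) (norm_add_le a b) 2).trans (add_sq_le_of_pos ht _ _)

theorem norm_add_pow_four_le_of_pos {t : ℝ} (ht : 0 < t) (a b : ℂ) :
    ‖a + b‖ ^ 4 ≤ (1 + t) ^ 3 * ‖a‖ ^ 4 + (1 + 1 / t) ^ 3 * ‖b‖ ^ 4 := by
  have h1 := norm_add_sq_le_of_pos ht a b
  calc ‖a + b‖ ^ 4 = (‖a + b‖ ^ 2) ^ 2 := by ring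
    _ ≤ ((1 + t) * ‖a‖ ^ 2 + (1 + 1 / t) * ‖b‖ ^ 2) ^ 2 := by gcongr
    _ ≤ (1 + t) * ((1 + t) * ‖a‖ ^ 2) ^ 2 + (1 + 1 / t) * ((1 + 1 / t) * ‖b‖ ^ 2) ^ 2 :=
        add_sq_le_of_pos ht _ _
    _ = _ := by ring

end Inequalities

section EdgeFunctionals

variable {J : Set ℝ} {f g f' g' : ℝ → ℂ} {ω : ℝ}

theorem edgeEnergy_const_mul (c : ℂ) :
    edgeEnergy ω J (fun x => c * f x) (fun x => c * g x) = ‖c‖ ^ 2 * edgeEnergy ω J f g := by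
  rw [edgeEnergy, edgeEnergy, ← integral_const_mul]
  congr 1
  ext x
  rw [norm_mul, norm_mul]
  ring

theorem quartic_const_mul (c : ℂ) : quartic J (fun x => c * f x) = ‖c‖ ^ 4 * quartic J f := by
  rw [quartic, quartic, ← integral_const_mul]
  congr 1
  ext x
  rw [norm_mul]
  ring

theorem IsH1Pair.edgeEnergy_parallelogram (h : IsH1Pair J f g) (h' : IsH1Pair J f' g')
    [J.OrdConnected] :
    edgeEnergy ω J (fun x => f x + f' x) (fun x => g x + g' x) +
      edgeEnergy ω J (fun x => f x - f' x) (fun x => g x - g' x) =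
      2 * edgeEnergy ω J f g + 2 * edgeEnergy ω J f' g' := by
  simp only [edgeEnergy]
  rw [← integral_add ((h.add h').integrable_energy ω) ((h.sub h').integrable_energy ω),
    ← integral_const_mul, ← integral_const_mul,
    ← integral_add ((h.integrable_energy ω).const_mul 2) ((h'.integrable_energy ω).const_mul 2)]
  congr 1
  ext x
  have h1 := parallelogram_law_with_norm ℝ (f x) (f' x)
  have h2 := parallelogram_law_with_norm ℝ (g x) (g' x)
  linear_combination h2 + ω * h1

theorem IsH1Pair.edgeEnergy_add_le (h : IsH1Pair J f g) (h' : IsH1Pair J f' g')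
    [J.OrdConnected] (hω : 0 ≤ ω) {t : ℝ} (ht : 0 < t) :
    edgeEnergy ω J (fun x => f x + f' x) (fun x => g x + g' x) ≤
      (1 + t) * edgeEnergy ω J f g + (1 + 1 / t) * edgeEnergy ω J f' g' := by
  simp only [edgeEnergy]
  rw [← integral_const_mul, ← integral_const_mul,
    ← integral_add ((h.integrable_energy ω).const_mul _) ((h'.integrable_energy ω).const_mul _)]
  refine integral_mono ((h.add h').integrable_energy ω)
    (((h.integrable_energy ω).const_mul _).add ((h'.integrable_energy ω).const_mul _)) fun x => ?_
  have h1 := mul_le_mul_of_nonneg_left (norm_add_sq_le_of_pos ht (f x) (f' x)) hω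
  have h2 := norm_add_sq_le_of_pos ht (g x) (g' x)
  dsimp only
  linarith

theorem quartic_add_le (hf : IntegrableOn (fun x => ‖f x‖ ^ 4) J)
    (hf' : IntegrableOn (fun x => ‖f' x‖ ^ 4) J) {t : ℝ} (ht : 0 < t) :
    quartic J (fun x => f x + f' x) ≤
      (1 + t) ^ 3 * quartic J f + (1 + 1 / t) ^ 3 * quartic J f' := by
  simp only [quartic]
  rw [← integral_const_mul, ← integral_const_mul,
    ← integral_add (hf.const_mul _) (hf'.const_mul _)]
  exact integral_mono_of_nonneg (Eventually.of_forall fun x => by positivity)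
    ((hf.const_mul _).add (hf'.const_mul _))
    (Eventually.of_forall fun x => norm_add_pow_four_le_of_pos ht _ _)

theorem IsH1Pair.integral_sq_le (h : IsH1Pair J f g) (hω : 0 < ω) :
    ∫ x in J, ‖f x‖ ^ 2 ≤ edgeEnergy ω J f g / ω := by
  rw [le_div_iff₀ hω, mul_comm, ← integral_const_mul]
  exact integral_mono (h.integrable_sq.const_mul ω) (h.integrable_energy ω) fun x => by
    dsimp only; nlinarith [sq_nonneg ‖g x‖]

theorem IsH1Pair.integral_deriv_sq_le (h : IsH1Pair J f g) (hω : 0 ≤ ω) :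
    ∫ x in J, ‖g x‖ ^ 2 ≤ edgeEnergy ω J f g :=
  integral_mono h.integrable_deriv_sq (h.integrable_energy ω) fun x => by
    have : 0 ≤ ω * ‖f x‖ ^ 2 := by positivity
    dsimp only; linarith

theorem IsH1Pair.edgeEnergy_mono (h : IsH1Pair J f g) (hω : 0 ≤ ω) {J' : Set ℝ} (hJ : J' ⊆ J) :
    edgeEnergy ω J' f g ≤ edgeEnergy ω J f g :=
  setIntegral_mono_set (h.integrable_energy ω) (Eventually.of_forall fun x => by positivity)
    hJ.eventuallyLE

/-- Comparison of the standard and the weighted squared `H¹` norms. -/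
theorem IsH1Pair.integral_add_le (h : IsH1Pair J f g) (hω : 0 < ω) :
    ∫ x in J, (‖g x‖ ^ 2 + ‖f x‖ ^ 2) ≤ (1 + 1 / ω) * edgeEnergy ω J f g := by
  rw [edgeEnergy, ← integral_const_mul]
  refine integral_mono (h.integrable_deriv_sq.add h.integrable_sq)
    ((h.integrable_energy ω).const_mul _) fun x => ?_
  have h1 : (1 + 1 / ω) * (‖g x‖ ^ 2 + ω * ‖f x‖ ^ 2) =
      ‖g x‖ ^ 2 + ‖f x‖ ^ 2 + (‖g x‖ ^ 2 / ω + ω * ‖f x‖ ^ 2) := by field_simp; ring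
  have : 0 ≤ ‖g x‖ ^ 2 / ω + ω * ‖f x‖ ^ 2 := by positivity
  dsimp only
  linarith

theorem setIntegral_Ici_eq_add {a b : ℝ} (hab : a ≤ b) {u : ℝ → ℝ} (hu : IntegrableOn u (Ici a)) :
    ∫ x in Ici a, u x = (∫ x in Icc a b, u x) + ∫ x in Ici b, u x := by
  rw [integral_Icc_eq_integral_Ico, ← setIntegral_union
    (by rw [Set.disjoint_left]; exact fun t h1 h2 => absurd h1.2 (not_lt.2 h2))
    measurableSet_Ici (hu.mono_set Ico_subset_Ici_self) (hu.mono_set (Ici_subset_Ici.2 hab)),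
    Ico_union_Ici_eq_Ici hab]

end EdgeFunctionals

/-! ### Exponential tails and gluing -/

section Gluing

/-- The exponentially decaying function with value `c` at `b`. -/
noncomputable def expTail (s b : ℝ) (c : ℂ) (x : ℝ) : ℂ := c * (Real.exp (-s * (x - b)) : ℝ)

theorem norm_expTail_sq (s b : ℝ) (c : ℂ) (x : ℝ) :
    ‖expTail s b c x‖ ^ 2 = ‖c‖ ^ 2 * Real.exp (2 * s * b) * Real.exp (-(2 * s) * x) := by
  rw [expTail, norm_mul, Complex.norm_real, Real.norm_of_nonneg (Real.exp_pos _).le, mul_pow,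
    ← Real.exp_nat_mul, mul_assoc, ← Real.exp_add]
  congr 2
  push_cast
  ring

theorem expTail_isH1Pair {s : ℝ} (hs : 0 < s) (b : ℝ) (c : ℂ) :
    IsH1Pair (Ici b) (expTail s b c) (fun x => -s * expTail s b c x) := by
  have hc : Continuous (expTail s b c) := by unfold expTail; fun_prop
  have h1 : MemLp (expTail s b c) 2 (volume.restrict (Ici b)) := by
    rw [memLp_two_iff_integrable_sq_norm hc.aestronglyMeasurable]
    simp only [norm_expTail_sq]
    have := (integrableOn_exp_mul_Ioi (a := -(2 * s)) (by linarith) b)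
    rw [← integrableOn_Ici_iff_integrableOn_Ioi] at this
    exact this.const_mul _
  refine ⟨h1, h1.const_mul _, fun x _ y _ _ => ?_⟩
  have hd : ∀ t, HasDerivAt (expTail s b c) (-s * expTail s b c t) t := fun t => by
    have e1 : HasDerivAt (fun t : ℝ => -s * (t - b)) (-s) t := by
      simpa using ((hasDerivAt_id t).sub_const b).const_mul (-s)
    have e2 := (e1.exp.ofReal_comp).const_mul c
    refine e2.congr_deriv ?_
    rw [expTail]
    push_cast
    ring
  exact (intervalIntegral.integral_eq_sub_of_hasDerivAt (fun t _ => hd t)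
    ((continuous_const.mul hc).intervalIntegrable _ _)).symm

/-- With decay rate √ω, kinetic and potential parts are equal. The result is exactly the boundary
term of `IsH1Pair.quartic_Ici_le`. -/
theorem edgeEnergy_expTail {ω : ℝ} (hω : 0 < ω) (b : ℝ) (c : ℂ) :
    edgeEnergy ω (Ici b) (expTail (√ω) b c) (fun x => -(√ω : ℝ) * expTail (√ω) b c x) =
      √ω * ‖c‖ ^ 2 := by
  have hs : 0 < √ω := Real.sqrt_pos.2 hω
  have hsω : √ω ^ 2 = ω := Real.sq_sqrt hω.le
  set s := √ω
  have h1 : ∀ x, ‖-(s : ℂ) * expTail s b c x‖ ^ 2 + ω * ‖expTail s b c x‖ ^ 2 =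
      2 * s ^ 2 * (‖c‖ ^ 2 * Real.exp (2 * s * b)) * Real.exp (-(2 * s) * x) := fun x => by
    rw [norm_mul, mul_pow, norm_expTail_sq, norm_neg, Complex.norm_real, Real.norm_of_nonneg hs.le,
      ← hsω]
    ring
  simp only [edgeEnergy, h1]
  rw [integral_const_mul, integral_Ici_eq_integral_Ioi, integral_exp_mul_Ioi (by linarith)]
  have h2 : Real.exp (2 * s * b) * Real.exp (-(2 * s) * b) = 1 := by
    rw [← Real.exp_add]; simp
  rw [show -(2 * s) * b = -(2 * s * b) by ring] at h2
  field_simp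
  linear_combination ‖c‖ ^ 2 * h2

variable {a b : ℝ} {f₁ g₁ f₂ g₂ : ℝ → ℂ}

theorem IsH1Pair.glue (h₁ : IsH1Pair (Icc a b) f₁ g₁) (h₂ : IsH1Pair (Ici b) f₂ g₂)
    (hfb : f₁ b = f₂ b) :
    IsH1Pair (Ici a) ((Iic b).piecewise f₁ f₂) ((Iic b).piecewise g₁ g₂) := by
  have e1 : Iic b ∩ Ici a = Icc a b := by ext; simp [and_comm]
  have e2 : (Iic b)ᶜ ∩ Ici a ⊆ Ici b := fun x hx => (not_le.1 (show ¬x ≤ b from hx.1)).le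
  have hm : ∀ {u v : ℝ → ℂ}, MemLp u 2 (volume.restrict (Icc a b)) →
      MemLp v 2 (volume.restrict (Ici b)) →
      MemLp ((Iic b).piecewise u v) 2 (volume.restrict (Ici a)) := fun hu hv => by
    refine MemLp.piecewise measurableSet_Iic ?_ ?_
    · rwa [Measure.restrict_restrict measurableSet_Iic, e1]
    · rw [Measure.restrict_restrict measurableSet_Iic.compl]
      exact hv.mono_measure (Measure.restrict_mono e2 le_rfl)
  have hG := hm h₁.memLp_deriv h₂.memLp_deriv
  have hle : ∀ {u v : ℝ → ℂ} {x : ℝ}, x ≤ b → (Iic b).piecewise u v x = u x := fun hx =>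
    piecewise_eq_of_mem _ _ _ hx
  have hgt : ∀ {u v : ℝ → ℂ} {x : ℝ}, b < x → (Iic b).piecewise u v x = v x := fun hx =>
    piecewise_eq_of_notMem _ _ _ (not_le.2 hx)
  have hge : ∀ {x : ℝ}, b ≤ x → (Iic b).piecewise f₁ f₂ x = f₂ x := fun hx => by
    rcases hx.eq_or_lt with rfl | hx
    · rw [hle le_rfl, hfb]
    · exact hgt hx
  have hl : ∀ x ∈ Ici a, ∀ y, x ≤ y → y ≤ b →
      (Iic b).piecewise f₁ f₂ y - (Iic b).piecewise f₁ f₂ x =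
        ∫ t in x..y, (Iic b).piecewise g₁ g₂ t := fun x hx y hxy hyb => by
    rw [hle hyb, hle (hxy.trans hyb), h₁.sub_eq x ⟨hx, hxy.trans hyb⟩ y ⟨le_trans hx hxy, hyb⟩ hxy]
    refine intervalIntegral.integral_congr fun t ht => ?_
    rw [uIcc_of_le hxy] at ht
    exact (hle (ht.2.trans hyb)).symm
  have hr : ∀ x, b ≤ x → ∀ y, x ≤ y →
      (Iic b).piecewise f₁ f₂ y - (Iic b).piecewise f₁ f₂ x =
        ∫ t in x..y, (Iic b).piecewise g₁ g₂ t := fun x hbx y hxy => by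
    rw [hge hbx, hge (hbx.trans hxy), h₂.sub_eq x hbx y (hbx.trans hxy) hxy]
    refine intervalIntegral.integral_congr_ae (Eventually.of_forall fun t ht => ?_)
    rw [uIoc_of_le hxy] at ht
    exact (hgt (hbx.trans_lt ht.1)).symm
  refine ⟨hm h₁.memLp h₂.memLp, hG, fun x hx y hy hxy => ?_⟩
  rcases le_total y b with hyb | hby
  · exact hl x hx y hxy hyb
  rcases le_total b x with hbx | hxb
  · exact hr x hbx y hxy
  have hb : b ∈ Ici a := le_trans hx hxb
  rw [← intervalIntegral.integral_add_adjacent_intervals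
    (intervalIntegrable_of_memLp_two hG hx hb) (intervalIntegrable_of_memLp_two hG hb hy),
    ← hl x hx b hxb le_rfl, ← hr b le_rfl y hby]
  ring

theorem IsH1Pair.edgeEnergy_glue (h₁ : IsH1Pair (Icc a b) f₁ g₁) (h₂ : IsH1Pair (Ici b) f₂ g₂)
    (hfb : f₁ b = f₂ b) (hab : a ≤ b) (ω : ℝ) :
    edgeEnergy ω (Ici a) ((Iic b).piecewise f₁ f₂) ((Iic b).piecewise g₁ g₂) =
      edgeEnergy ω (Icc a b) f₁ g₁ + edgeEnergy ω (Ici b) f₂ g₂ := by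
  rw [edgeEnergy, setIntegral_Ici_eq_add hab ((h₁.glue h₂ hfb).integrable_energy ω)]
  congr 1
  · refine setIntegral_congr_fun measurableSet_Icc fun x hx => ?_
    have hxb : x ∈ Iic b := hx.2
    simp [hxb.out]
  · rw [edgeEnergy, integral_Ici_eq_integral_Ioi, integral_Ici_eq_integral_Ioi]
    refine setIntegral_congr_fun measurableSet_Ioi fun x hx => ?_
    have hxb : ¬ x ≤ b := not_le.2 hx
    simp [hxb]

end Gluing

/-! ### Completeness and compactness on an edge -/

theorem norm_toLp_two_sq {α : Type*} [MeasurableSpace α] {μ : Measure α} {u : α → ℂ}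
    (hu : MemLp u 2 μ) : ‖hu.toLp u‖ ^ 2 = ∫ x, ‖u x‖ ^ 2 ∂μ := by
  have h0 : 0 ≤ ∫ x, ‖u x‖ ^ 2 ∂μ := integral_nonneg fun x => by positivity
  rw [Lp.norm_toLp, hu.eLpNorm_eq_integral_rpow_norm (by norm_num) (by norm_num),
    ENNReal.toReal_ofReal (by positivity)]
  simp only [ENNReal.toReal_ofNat, Real.rpow_ofNat]
  rw [← Real.rpow_natCast, ← Real.rpow_mul h0]
  norm_num

/-- Completeness of `L²`, for sequences of functions. -/
theorem exists_limit_of_cauchy_two {α : Type*} [MeasurableSpace α] {μ : Measure α}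
    {u : ℕ → α → ℂ} (hu : ∀ n, MemLp (u n) 2 μ)
    (hC : ∀ ε > 0, ∃ N, ∀ n ≥ N, ∀ m ≥ N, ∫ x, ‖u n x - u m x‖ ^ 2 ∂μ ≤ ε) :
    ∃ v, MemLp v 2 μ ∧ Tendsto (fun n => eLpNorm (u n - v) 2 μ) atTop (𝓝 0) ∧
      Tendsto (fun n => ∫ x, ‖u n x - v x‖ ^ 2 ∂μ) atTop (𝓝 0) := by
  set U : ℕ → Lp ℂ 2 μ := fun n => (hu n).toLp (u n) with hU
  have hUC : CauchySeq U := by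
    refine Metric.cauchySeq_iff.2 fun ε hε => ?_
    obtain ⟨N, hN⟩ := hC ((ε / 2) ^ 2) (by positivity)
    refine ⟨N, fun n hn m hm => ?_⟩
    have h1 : ‖U n - U m‖ ^ 2 ≤ (ε / 2) ^ 2 := by
      simp only [hU]
      rw [← MemLp.toLp_sub, norm_toLp_two_sq]
      exact hN n hn m hm
    rw [dist_eq_norm]
    linarith [(pow_le_pow_iff_left₀ (norm_nonneg _) (by positivity) two_ne_zero).1 h1]
  obtain ⟨V, hV⟩ := cauchySeq_tendsto_of_complete hUC
  have hVm : MemLp V 2 μ := Lp.memLp V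
  refine ⟨V, hVm, ?_, ?_⟩
  · rw [← Lp.tendsto_Lp_iff_tendsto_eLpNorm'' u hu V hVm, Lp.toLp_coeFn]
    exact hV
  · have h1 : Tendsto (fun n => ‖U n - V‖ ^ 2) atTop (𝓝 0) := by
      simpa using (tendsto_iff_norm_sub_tendsto_zero.1 hV).pow 2
    refine h1.congr fun n => ?_
    have h2 : U n - V = ((hu n).sub hVm).toLp (u n - ⇑V) := by
      rw [MemLp.toLp_sub (hu n) hVm, Lp.toLp_coeFn]
    rw [h2, norm_toLp_two_sq]
    rfl

/-- A Cauchy sequence in `H¹(J)` which converges pointwise converges in `H¹(J)` to its pointwise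
limit. -/
theorem IsH1Pair.exists_limit {J : Set ℝ} [J.OrdConnected] (hJ : MeasurableSet J) {ω : ℝ}
    (hω : 0 < ω) {f g : ℕ → ℝ → ℂ} (h : ∀ n, IsH1Pair J (f n) (g n)) {F : ℝ → ℂ}
    (hF : ∀ x ∈ J, Tendsto (fun n => f n x) atTop (𝓝 (F x)))
    (hC : ∀ ε > 0, ∃ N, ∀ n ≥ N, ∀ m ≥ N,
      edgeEnergy ω J (fun x => f n x - f m x) (fun x => g n x - g m x) ≤ ε) :
    ∃ G, IsH1Pair J F G ∧ Tendsto (fun n => edgeEnergy ω J (fun x => f n x - F x)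
      (fun x => g n x - G x)) atTop (𝓝 0) := by
  obtain ⟨G, hG, -, hG0⟩ := exists_limit_of_cauchy_two (fun n => (h n).memLp_deriv)
    fun ε hε => by
      obtain ⟨N, hN⟩ := hC ε hε
      exact ⟨N, fun n hn m hm =>
        (((h n).sub (h m)).integral_deriv_sq_le hω.le).trans (hN n hn m hm)⟩
  obtain ⟨H, hH, hHe, hH0⟩ := exists_limit_of_cauchy_two (fun n => (h n).memLp)
    fun ε hε => by
      obtain ⟨N, hN⟩ := hC (ε * ω) (by positivity)
      exact ⟨N, fun n hn m hm => (((h n).sub (h m)).integral_sq_le hω).trans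
        ((div_le_iff₀ hω).2 (hN n hn m hm))⟩
  -- L² convergence gives a subsequence converging a.e., so the L² limit is the pointwise limit.
  have hHF : H =ᵐ[volume.restrict J] F := by
    obtain ⟨ns, hns, hae⟩ := (tendstoInMeasure_of_tendsto_eLpNorm (by norm_num)
      (fun n => (h n).memLp.1) hH.1 hHe).exists_seq_tendsto_ae
    filter_upwards [hae, ae_restrict_mem hJ] with x hx hxJ
    exact tendsto_nhds_unique hx ((hF x hxJ).comp hns.tendsto_atTop)
  have hFm : MemLp F 2 (volume.restrict J) := (memLp_congr_ae hHF).1 hH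
  have hpair : IsH1Pair J F G := by
    refine ⟨hFm, hG, fun x hx y hy hxy => ?_⟩
    refine tendsto_nhds_unique ((hF y hy).sub (hF x hx)) ?_
    rw [tendsto_iff_norm_sub_tendsto_zero]
    refine Metric.tendsto_atTop.2 fun ε hε => ?_
    -- This makes |y - x|/(4δ) ≤ ε/4; then n is taken so large that δ∫‖gₙ - G‖² < ε/2.
    set δ := (|y - x| + 1) / ε
    have hδ : 0 < δ := by positivity
    obtain ⟨N, hN⟩ := Metric.tendsto_atTop.1 hG0 (ε / (2 * δ)) (by positivity)
    refine ⟨N, fun n hn => ?_⟩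
    have hsub : MemLp (fun t => g n t - G t) 2 (volume.restrict J) := (h n).memLp_deriv.sub hG
    have h1 := norm_sub_le_of_memLp_two hsub
      (f := fun z => ∫ t in x..z, (g n t - G t)) (fun p hp q hq _ =>
        intervalIntegral.integral_interval_sub_left (intervalIntegrable_of_memLp_two hsub hx hq)
          (intervalIntegrable_of_memLp_two hsub hx hp)) hδ hx hy
    have h2 := hN n hn
    rw [dist_zero_right, Real.norm_of_nonneg (integral_nonneg fun x => by positivity)] at h2
    rw [intervalIntegral.integral_same, sub_zero, intervalIntegral.integral_sub
      ((h n).intervalIntegrable hx hy) (intervalIntegrable_of_memLp_two hG hx hy),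
      ← (h n).sub_eq x hx y hy hxy] at h1
    rw [dist_zero_right, norm_norm]
    refine h1.trans_lt ?_
    have h3 : δ * (∫ t in J, ‖g n t - G t‖ ^ 2) < ε / 2 := by
      rw [lt_div_iff₀ (by positivity)] at h2
      linarith
    have h4 : |y - x| / (4 * δ) ≤ ε / 4 := by
      rw [div_le_iff₀ (by positivity)]
      have : ε / 4 * (4 * δ) = |y - x| + 1 := by simp only [δ]; field_simp
      linarith
    linarith
  refine ⟨G, hpair, ?_⟩
  have h5 : Tendsto (fun n => (∫ x in J, ‖g n x - G x‖ ^ 2) + ω * ∫ x in J, ‖f n x - H x‖ ^ 2)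
      atTop (𝓝 0) := by simpa using hG0.add (hH0.const_mul ω)
  refine h5.congr fun n => ?_
  have h6 : ∫ x in J, ‖f n x - H x‖ ^ 2 = ∫ x in J, ‖f n x - F x‖ ^ 2 :=
    integral_congr_ae (by filter_upwards [hHF] with x hx; rw [hx])
  have h7 := (h n).sub hpair
  rw [h6, edgeEnergy, integral_add h7.integrable_deriv_sq (h7.integrable_sq.const_mul ω),
    integral_const_mul]

/-- A uniformly bounded and uniformly equicontinuous sequence on `J` has a subsequence which
converges pointwise on `J`. -/
theorem exists_subseq_tendsto_of_equicontinuous {J : Set ℝ} {f : ℕ → ℝ → ℂ} {B : ℝ}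
    (hB : ∀ n, ∀ x ∈ J, ‖f n x‖ ≤ B)
    (heq : ∀ ε > 0, ∃ δ > 0, ∀ n, ∀ x ∈ J, ∀ y ∈ J, |y - x| < δ → ‖f n y - f n x‖ ≤ ε) :
    ∃ φ : ℕ → ℕ, StrictMono φ ∧
      ∃ F : ℝ → ℂ, ∀ x ∈ J, Tendsto (fun n => f (φ n) x) atTop (𝓝 (F x)) := by
  obtain ⟨D, hDc, hD⟩ := TopologicalSpace.exists_countable_dense J
  have : Countable D := hDc.to_subtype
  -- A product over a countable dense set is sequentially compact, which replaces the diagonal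
  -- argument; equicontinuity carries convergence from D to J.
  have hK : IsCompact (Set.pi univ fun _ : D => Metric.closedBall (0 : ℂ) B) :=
    isCompact_univ_pi fun _ => isCompact_closedBall _ _
  obtain ⟨v, -, φ, hφ, hv⟩ := hK.tendsto_subseq
    (x := fun n => fun d : D => f n (d : J)) (fun n d _ => by
      simpa using hB n (d : J) (d : J).2)
  refine ⟨φ, hφ, ?_⟩
  have hlim : ∀ x ∈ J, ∃ l, Tendsto (fun n => f (φ n) x) atTop (𝓝 l) := by
    intro x hx
    refine cauchySeq_tendsto_of_complete (Metric.cauchySeq_iff.2 fun ε hε => ?_)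
    obtain ⟨δ, hδ, hδε⟩ := heq (ε / 4) (by positivity)
    obtain ⟨d, hdD, hd⟩ := Metric.mem_closure_iff.1 (hD (⟨x, hx⟩ : J)) δ hδ
    have hdx : |(d : ℝ) - x| < δ := by
      rw [dist_comm] at hd
      simpa [Subtype.dist_eq, Real.dist_eq] using hd
    have hcd : CauchySeq fun n => f (φ n) d :=
      (tendsto_pi_nhds.1 hv ⟨d, hdD⟩).cauchySeq
    obtain ⟨N, hN⟩ := Metric.cauchySeq_iff.1 hcd (ε / 4) (by positivity)
    refine ⟨N, fun n hn m hm => ?_⟩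
    have h1 := hδε (φ n) x hx d d.2 hdx
    have h2 := hδε (φ m) x hx d d.2 hdx
    have h3 := hN n hn m hm
    rw [dist_eq_norm] at h3 ⊢
    have h4 : f (φ n) x - f (φ m) x = -(f (φ n) d - f (φ n) x) +
        (f (φ n) d - f (φ m) d) + (f (φ m) d - f (φ m) x) := by ring
    rw [h4]
    refine (norm_add₃_le).trans_lt ?_
    rw [norm_neg]
    linarith
  choose! F hF using hlim
  exact ⟨F, hF⟩

theorem IsH1Pair.exists_subseq_tendsto {J : Set ℝ} [J.OrdConnected] {f g : ℕ → ℝ → ℂ}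
    (h : ∀ n, IsH1Pair J (f n) (g n)) {B A : ℝ} (hB : ∀ n, ∀ x ∈ J, ‖f n x‖ ^ 2 ≤ B)
    (hA : ∀ n, ∫ x in J, ‖g n x‖ ^ 2 ≤ A) :
    ∃ φ : ℕ → ℕ, StrictMono φ ∧
      ∃ F : ℝ → ℂ, ∀ x ∈ J, Tendsto (fun n => f (φ n) x) atTop (𝓝 (F x)) := by
  have hA0 : 0 ≤ A := le_trans (integral_nonneg fun x => by positivity) (hA 0)
  refine exists_subseq_tendsto_of_equicontinuous (B := √B)
    (fun n x hx => Real.le_sqrt_of_sq_le (hB n x hx)) fun ε hε => ?_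
  set δ := ε / (2 * (A + 1))
  have hδ : 0 < δ := by positivity
  refine ⟨2 * δ * ε, by positivity, fun n x hx y hy hxy => ?_⟩
  refine ((h n).norm_sub_le hδ hx hy).trans ?_
  have h1 : δ * (∫ t in J, ‖g n t‖ ^ 2) ≤ ε / 2 := by
    have e1 : δ * (A + 1) = ε / 2 := by simp only [δ]; field_simp
    have e2 := mul_le_mul_of_nonneg_left (hA n) hδ.le
    linarith
  have h2 : |y - x| / (4 * δ) ≤ ε / 2 := by
    rw [div_le_iff₀ (by positivity)]
    linarith
  linarith

/-- Bounded pointwise convergent sequences on a set of finite measure are Cauchy in `L⁴`. -/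
theorem quartic_sub_tendsto_zero {K : Set ℝ} (hK : MeasurableSet K) (hKf : volume K ≠ ⊤)
    {f : ℕ → ℝ → ℂ} (hm : ∀ n, AEStronglyMeasurable (f n) (volume.restrict K)) {B : ℝ}
    (hB : ∀ n, ∀ x ∈ K, ‖f n x‖ ^ 2 ≤ B) {F : ℝ → ℂ}
    (hF : ∀ x ∈ K, Tendsto (fun n => f n x) atTop (𝓝 (F x))) :
    ∀ ε > 0, ∃ N, ∀ n ≥ N, ∀ m ≥ N, quartic K (fun x => f n x - f m x) ≤ ε := by
  have h1 : Tendsto (fun p : ℕ × ℕ => quartic K (fun x => f p.1 x - f p.2 x)) atTop (𝓝 0) := by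
    have h0 : (0 : ℝ) = ∫ _ in K, (0 : ℝ) := by simp
    rw [h0]
    -- Dominated convergence along pairs (n, m); the bound comes from |a - b|² ≤ 2|a|² + 2|b|² ≤ 4B.
    refine tendsto_integral_filter_of_dominated_convergence (fun _ => (4 * B) ^ 2)
      (Eventually.of_forall fun p => ((hm p.1).sub (hm p.2)).norm.pow 4)
      (Eventually.of_forall fun p => (ae_restrict_iff' hK).2 (Eventually.of_forall fun x hx => ?_))
      (integrableOn_const hKf) ((ae_restrict_iff' hK).2 (Eventually.of_forall fun x hx => ?_))
    · rw [Real.norm_of_nonneg (by positivity)]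
      have e1 := norm_add_sq_le_of_pos one_pos (f p.1 x) (-f p.2 x)
      rw [← sub_eq_add_neg, norm_neg] at e1
      have e2 : ‖f p.1 x - f p.2 x‖ ^ 2 ≤ 4 * B := by linarith [hB p.1 x hx, hB p.2 x hx]
      calc ‖f p.1 x - f p.2 x‖ ^ 4 = (‖f p.1 x - f p.2 x‖ ^ 2) ^ 2 := by ring
        _ ≤ _ := by gcongr
    · have e1 : Tendsto (fun p : ℕ × ℕ => f p.1 x - f p.2 x) atTop (𝓝 (F x - F x)) := by
        rw [← prod_atTop_atTop_eq]
        exact ((hF x hx).comp tendsto_fst).sub ((hF x hx).comp tendsto_snd)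
      simpa using e1.norm.pow 4
  intro ε hε
  obtain ⟨⟨N, M⟩, hNM⟩ := eventually_atTop.1 (h1.eventually (eventually_le_nhds hε))
  exact ⟨max N M, fun n hn m hm => hNM (n, m) ⟨(le_max_left _ _).trans hn,
    (le_max_right _ _).trans hm⟩⟩

/-! ### Energy and quartic functionals on the graph -/

namespace TadpoleFun

instance : Add TadpoleFun := ⟨fun u v => ⟨fun x => u.c x + v.c x, fun x => u.h x + v.h x⟩⟩

instance : Sub TadpoleFun := ⟨fun u v => ⟨fun x => u.c x - v.c x, fun x => u.h x - v.h x⟩⟩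

instance : SMul ℂ TadpoleFun := ⟨fun z u => ⟨fun x => z * u.c x, fun x => z * u.h x⟩⟩

/-- `d` is an edgewise derivative of `u`, in primitive form, and `u` is continuous at the vertex. -/
structure IsGraphPair (L : ℝ) (u d : TadpoleFun) : Prop where
  loop : IsH1Pair (Icc (-L) L) u.c d.c
  half : IsH1Pair (Ici 0) u.h d.h
  loop_eq : u.c L = u.c (-L)
  vertex_eq : u.c (-L) = u.h 0

/-- `Q(u) + ω ‖u‖²`, with the derivative given by `d`. -/
noncomputable def graphEnergy (ω γ L : ℝ) (u d : TadpoleFun) : ℝ :=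
  edgeEnergy ω (Icc (-L) L) u.c d.c + edgeEnergy ω (Ici 0) u.h d.h + γ * ‖u.h 0‖ ^ 2

/-- `‖u‖_{L⁴}⁴`. -/
noncomputable def graphQuartic (L : ℝ) (u : TadpoleFun) : ℝ :=
  quartic (Icc (-L) L) u.c + quartic (Ici 0) u.h

variable {ω γ L : ℝ} {u d v e : TadpoleFun}

theorem hasWeakDerivOn_weakDeriv {I : Set ℝ} {f g : ℝ → ℂ} (h : HasWeakDerivOn I f g) :
    HasWeakDerivOn I f (weakDeriv I f) := by
  have hex : ∃ g, HasWeakDerivOn I f g := ⟨g, h⟩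
  rw [weakDeriv, dif_pos hex]
  exact hex.choose_spec

theorem weakDeriv_ae_eq {I : Set ℝ} (hI : IsOpen I) {f g : ℝ → ℂ} (h : HasWeakDerivOn I f g) :
    weakDeriv I f =ᵐ[volume.restrict I] g :=
  (ae_restrict_iff' hI.measurableSet).2 (HasWeakDerivOn.ae_eq hI (hasWeakDerivOn_weakDeriv h) h)

theorem mem_H1D_iff (hL : 0 < L) : u ∈ H1D L ↔ ∃ d, IsGraphPair L u d := by
  have hL' : -L < L := by linarith
  constructor
  · rintro ⟨⟨hc, gc, hgc, hgc2⟩, hcc, ⟨hh, gh, hgh, hgh2⟩, hhc, h1, h2⟩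
    refine ⟨⟨gc, gh⟩, ?_, ?_, h1, h2⟩
    · exact hgc.isH1Pair isOpen_Ioo (nonempty_Ioo.2 hL') Ioo_subset_Icc_self
        (by rw [closure_Ioo hL'.ne]) Ioo_ae_eq_Icc.symm hc hgc2 hcc
    · exact hgh.isH1Pair isOpen_Ioi nonempty_Ioi Ioi_subset_Ici_self
        (by rw [closure_Ioi]) Ioi_ae_eq_Ici.symm hh hgh2 hhc
  · rintro ⟨d, hc, hh, h1, h2⟩
    have hc' := hc.mono Ioo_subset_Icc_self
    have hh' := hh.mono Ioi_subset_Ici_self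
    exact ⟨⟨hc'.memLp, d.c, hc.hasWeakDerivOn isOpen_Ioo Ioo_subset_Icc_self, hc'.memLp_deriv⟩,
      hc.continuousOn,
      ⟨hh'.memLp, d.h, hh.hasWeakDerivOn isOpen_Ioi Ioi_subset_Ici_self, hh'.memLp_deriv⟩,
      hh.continuousOn, h1, h2⟩

theorem lpNormPow_four : u.lpNormPow L 4 = graphQuartic L u := by
  rw [lpNormPow, graphQuartic, quartic, quartic, integral_Icc_eq_integral_Ioo,
    integral_Ici_eq_integral_Ioi]

namespace IsGraphPair

/-- `weakDeriv` is a chosen representative, but weak derivatives are a.e. unique, so any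
primitive-form derivative d may be used. -/
theorem quadForm_add (h : IsGraphPair L u d) :
    u.quadForm γ L + ω * u.lpNormPow L 2 = graphEnergy ω γ L u d := by
  have e1 : ∫ x in Ioo (-L) L, ‖weakDeriv (Ioo (-L) L) u.c x‖ ^ 2 = ∫ x in Ioo (-L) L, ‖d.c x‖ ^ 2 :=
    integral_congr_ae (by
      filter_upwards [weakDeriv_ae_eq isOpen_Ioo
        (h.loop.hasWeakDerivOn isOpen_Ioo Ioo_subset_Icc_self)] with x hx
      rw [hx])
  have e2 : ∫ x in Ioi (0 : ℝ), ‖weakDeriv (Ioi 0) u.h x‖ ^ 2 = ∫ x in Ioi (0 : ℝ), ‖d.h x‖ ^ 2 :=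
    integral_congr_ae (by
      filter_upwards [weakDeriv_ae_eq isOpen_Ioi
        (h.half.hasWeakDerivOn isOpen_Ioi Ioi_subset_Ici_self)] with x hx
      rw [hx])
  simp only [quadForm, lpNormPow, wderiv, vertexValue, graphEnergy, edgeEnergy]
  rw [e1, e2, integral_add h.loop.integrable_deriv_sq (h.loop.integrable_sq.const_mul ω),
    integral_add h.half.integrable_deriv_sq (h.half.integrable_sq.const_mul ω),
    integral_const_mul, integral_const_mul, integral_Icc_eq_integral_Ioo,
    integral_Icc_eq_integral_Ioo, integral_Ici_eq_integral_Ioi, integral_Ici_eq_integral_Ioi]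
  ring

theorem nehari_eq (h : IsGraphPair L u d) :
    u.nehari ω γ L = graphEnergy ω γ L u d - graphQuartic L u := by
  rw [nehari, h.quadForm_add, lpNormPow_four]

theorem action_eq (h : IsGraphPair L u d) :
    u.action ω γ L = 1 / 2 * graphEnergy ω γ L u d - 1 / 4 * graphQuartic L u := by
  rw [action, ← h.quadForm_add, lpNormPow_four]
  ring

theorem add (h : IsGraphPair L u d) (h' : IsGraphPair L v e) : IsGraphPair L (u + v) (d + e) :=
  ⟨h.loop.add h'.loop, h.half.add h'.half, congrArg₂ (· + ·) h.loop_eq h'.loop_eq,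
    congrArg₂ (· + ·) h.vertex_eq h'.vertex_eq⟩

theorem sub (h : IsGraphPair L u d) (h' : IsGraphPair L v e) : IsGraphPair L (u - v) (d - e) :=
  ⟨h.loop.sub h'.loop, h.half.sub h'.half, congrArg₂ (· - ·) h.loop_eq h'.loop_eq,
    congrArg₂ (· - ·) h.vertex_eq h'.vertex_eq⟩

theorem smul (h : IsGraphPair L u d) (z : ℂ) : IsGraphPair L (z • u) (z • d) :=
  ⟨h.loop.const_mul z, h.half.const_mul z, congrArg (z * ·) h.loop_eq,
    congrArg (z * ·) h.vertex_eq⟩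

end IsGraphPair

theorem graphEnergy_smul (z : ℂ) :
    graphEnergy ω γ L (z • u) (z • d) = ‖z‖ ^ 2 * graphEnergy ω γ L u d := by
  change edgeEnergy ω _ (fun x => z * u.c x) (fun x => z * d.c x) +
    edgeEnergy ω _ (fun x => z * u.h x) (fun x => z * d.h x) + γ * ‖z * u.h 0‖ ^ 2 = _
  rw [edgeEnergy_const_mul, edgeEnergy_const_mul, norm_mul, graphEnergy]
  ring

theorem graphQuartic_smul (z : ℂ) : graphQuartic L (z • u) = ‖z‖ ^ 4 * graphQuartic L u := by
  change quartic _ (fun x => z * u.c x) + quartic _ (fun x => z * u.h x) = _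
  rw [quartic_const_mul, quartic_const_mul, graphQuartic]
  ring

theorem graphEnergy_nonneg (hω : 0 ≤ ω) (hγ : 0 ≤ γ) : 0 ≤ graphEnergy ω γ L u d :=
  add_nonneg (add_nonneg (edgeEnergy_nonneg hω _ _ _) (edgeEnergy_nonneg hω _ _ _))
    (by positivity)

theorem graphQuartic_nonneg : 0 ≤ graphQuartic L u :=
  add_nonneg (quartic_nonneg _ _) (quartic_nonneg _ _)

theorem edgeEnergy_half_le (hω : 0 ≤ ω) (hγ : 0 ≤ γ) :
    edgeEnergy ω (Ici 0) u.h d.h ≤ graphEnergy ω γ L u d := by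
  have := edgeEnergy_nonneg hω (Icc (-L) L) u.c d.c
  have : 0 ≤ γ * ‖u.h 0‖ ^ 2 := by positivity
  rw [graphEnergy]
  linarith

theorem edgeEnergy_loop_le (hω : 0 ≤ ω) (hγ : 0 ≤ γ) :
    edgeEnergy ω (Icc (-L) L) u.c d.c ≤ graphEnergy ω γ L u d := by
  have := edgeEnergy_nonneg hω (Ici 0) u.h d.h
  have : 0 ≤ γ * ‖u.h 0‖ ^ 2 := by positivity
  rw [graphEnergy]
  linarith

namespace IsGraphPair

theorem energy_parallelogram (h : IsGraphPair L u d) (h' : IsGraphPair L v e) :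
    graphEnergy ω γ L (u + v) (d + e) + graphEnergy ω γ L (u - v) (d - e) =
      2 * graphEnergy ω γ L u d + 2 * graphEnergy ω γ L v e := by
  have h1 := h.loop.edgeEnergy_parallelogram (ω := ω) h'.loop
  have h2 := h.half.edgeEnergy_parallelogram (ω := ω) h'.half
  have h3 := parallelogram_law_with_norm ℝ (u.h 0) (v.h 0)
  change (edgeEnergy ω _ (fun x => u.c x + v.c x) (fun x => d.c x + e.c x) +
    edgeEnergy ω _ (fun x => u.h x + v.h x) (fun x => d.h x + e.h x) +
      γ * ‖u.h 0 + v.h 0‖ ^ 2) + (edgeEnergy ω _ (fun x => u.c x - v.c x) (fun x => d.c x - e.c x) +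
    edgeEnergy ω _ (fun x => u.h x - v.h x) (fun x => d.h x - e.h x) +
      γ * ‖u.h 0 - v.h 0‖ ^ 2) = _
  simp only [graphEnergy]
  linear_combination h1 + h2 + γ * h3

theorem energy_add_le (h : IsGraphPair L u d) (h' : IsGraphPair L v e) (hω : 0 ≤ ω) (hγ : 0 ≤ γ)
    {t : ℝ} (ht : 0 < t) : graphEnergy ω γ L (u + v) (d + e) ≤
      (1 + t) * graphEnergy ω γ L u d + (1 + 1 / t) * graphEnergy ω γ L v e := by
  have h1 := h.loop.edgeEnergy_add_le h'.loop hω ht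
  have h2 := h.half.edgeEnergy_add_le h'.half hω ht
  have h3 := mul_le_mul_of_nonneg_left (norm_add_sq_le_of_pos ht (u.h 0) (v.h 0)) hγ
  change edgeEnergy ω _ (fun x => u.c x + v.c x) (fun x => d.c x + e.c x) +
    edgeEnergy ω _ (fun x => u.h x + v.h x) (fun x => d.h x + e.h x) +
      γ * ‖u.h 0 + v.h 0‖ ^ 2 ≤ _
  simp only [graphEnergy]
  linarith

theorem norm_sq_half_le (h : IsGraphPair L u d) (hω : 0 < ω) (hγ : 0 ≤ γ) :
    ∀ x ∈ Ici (0 : ℝ), ‖u.h x‖ ^ 2 ≤ (1 + 1 / ω) * graphEnergy ω γ L u d := by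
  intro x hx
  have h1 := h.half.norm_sq_le_of_Ici hx
  have h2 := (h.half.mono (Ici_subset_Ici.2 hx)).integral_add_le hω
  have h3 := (h.half.edgeEnergy_mono hω.le (Ici_subset_Ici.2 hx)).trans
    (edgeEnergy_half_le (u := u) (d := d) (L := L) hω.le hγ)
  exact h1.trans (h2.trans (mul_le_mul_of_nonneg_left h3 (by positivity)))

/-- Go along the loop from x to the vertex, then out along the half-line to infinity, where u
vanishes. The constant therefore does not depend on L. -/
theorem norm_sq_loop_le (h : IsGraphPair L u d) (hω : 0 < ω) (hγ : 0 ≤ γ) :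
    ∀ x ∈ Icc (-L) L, ‖u.c x‖ ^ 2 ≤ (1 + 1 / ω) * graphEnergy ω γ L u d := by
  intro x hx
  have hL : -L ∈ Icc (-L) L := ⟨le_rfl, hx.1.trans hx.2⟩
  have hsub : Icc (-L) x ⊆ Icc (-L) L := Icc_subset_Icc_right hx.2
  have h1 := (abs_le.1 (h.loop.abs_sq_sub_sq_le hL hx hx.1)).2
  have h2 := (h.loop.mono hsub).integral_add_le hω
  have h3 := h.loop.edgeEnergy_mono hω.le hsub
  have h4 := h.half.norm_sq_le_of_Ici le_rfl
  have h5 := h.half.integral_add_le hω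
  have h6 : (1 + 1 / ω) * (edgeEnergy ω (Icc (-L) x) u.c d.c + edgeEnergy ω (Ici 0) u.h d.h) ≤
      (1 + 1 / ω) * graphEnergy ω γ L u d := by
    refine mul_le_mul_of_nonneg_left ?_ (by positivity)
    have : 0 ≤ γ * ‖u.h 0‖ ^ 2 := by positivity
    rw [graphEnergy]
    linarith
  rw [h.vertex_eq] at h1
  linarith

theorem integrable_quartic_loop (h : IsGraphPair L u d) :
    IntegrableOn (fun x => ‖u.c x‖ ^ 4) (Icc (-L) L) :=
  -- Only some finite bound matters, so ω = γ = 1 is taken.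
  h.loop.integrable_quartic measurableSet_Icc (h.norm_sq_loop_le one_pos zero_le_one)

theorem integrable_quartic_half (h : IsGraphPair L u d) :
    IntegrableOn (fun x => ‖u.h x‖ ^ 4) (Ici 0) :=
  h.half.integrable_quartic measurableSet_Ici (h.norm_sq_half_le one_pos zero_le_one)

theorem quartic_add_le (h : IsGraphPair L u d) (h' : IsGraphPair L v e) {t : ℝ} (ht : 0 < t) :
    graphQuartic L (u + v) ≤
      (1 + t) ^ 3 * graphQuartic L u + (1 + 1 / t) ^ 3 * graphQuartic L v := by
  have h1 := _root_.quartic_add_le h.integrable_quartic_loop h'.integrable_quartic_loop ht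
  have h2 := _root_.quartic_add_le h.integrable_quartic_half h'.integrable_quartic_half ht
  change quartic _ (fun x => u.c x + v.c x) + quartic _ (fun x => u.h x + v.h x) ≤ _
  simp only [graphQuartic]
  linarith

theorem quartic_le_energy_sq (h : IsGraphPair L u d) (hω : 0 < ω) (hγ : 0 ≤ γ) :
    graphQuartic L u ≤ (1 + 1 / ω) / ω * graphEnergy ω γ L u d ^ 2 := by
  set E := graphEnergy ω γ L u d with hE
  have hE0 : 0 ≤ E := graphEnergy_nonneg hω.le hγ
  have h1 := h.loop.quartic_le measurableSet_Icc (h.norm_sq_loop_le hω hγ)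
  have h2 := h.half.quartic_le measurableSet_Ici (h.norm_sq_half_le hω hγ)
  have h3 := h.loop.integral_sq_le hω
  have h4 := h.half.integral_sq_le hω
  have h5 : (∫ x in Icc (-L) L, ‖u.c x‖ ^ 2) + ∫ x in Ici (0 : ℝ), ‖u.h x‖ ^ 2 ≤ E / ω := by
    have h6 : (edgeEnergy ω (Icc (-L) L) u.c d.c + edgeEnergy ω (Ici 0) u.h d.h) / ω ≤ E / ω := by
      have : 0 ≤ γ * ‖u.h 0‖ ^ 2 := by positivity
      gcongr
      rw [hE, graphEnergy]
      linarith
    rw [add_div] at h6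
    linarith
  have h7 := mul_le_mul_of_nonneg_left h5 (show 0 ≤ (1 + 1 / ω) * E by positivity)
  rw [graphQuartic]
  calc _ ≤ (1 + 1 / ω) * E * (E / ω) := by linarith
    _ = _ := by ring

theorem isZero_of_energy_eq_zero (h : IsGraphPair L u d) (hω : 0 < ω) (hγ : 0 ≤ γ)
    (h0 : graphEnergy ω γ L u d = 0) : u.IsZero L := by
  refine ⟨fun x hx => ?_, fun x hx => ?_⟩
  · have := h.norm_sq_loop_le hω hγ x hx
    rw [h0, mul_zero] at this
    exact norm_eq_zero.1 (pow_eq_zero_iff two_ne_zero |>.1 (le_antisymm this (by positivity)))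
  · have := h.norm_sq_half_le hω hγ x hx
    rw [h0, mul_zero] at this
    exact norm_eq_zero.1 (pow_eq_zero_iff two_ne_zero |>.1 (le_antisymm this (by positivity)))

theorem not_isZero_of_quartic_pos (h0 : 0 < graphQuartic L u) : ¬ u.IsZero L := by
  rintro ⟨h1, h2⟩
  have e1 : quartic (Icc (-L) L) u.c = 0 := by
    rw [quartic, setIntegral_congr_fun measurableSet_Icc (g := fun _ => (0 : ℝ))
      fun x hx => by simp [h1 x hx]]
    simp
  have e2 : quartic (Ici 0) u.h = 0 := by
    rw [quartic, setIntegral_congr_fun measurableSet_Ici (g := fun _ => (0 : ℝ))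
      fun x hx => by simp [h2 x hx]]
    simp
  rw [graphQuartic, e1, e2] at h0
  simp at h0

/-- Replacing the function beyond `R` on the half-line by an exponential tail. -/
theorem exists_cut (h : IsGraphPair L u d) (hω : 0 < ω) {R : ℝ} (hR : 0 ≤ R) :
    ∃ v e, IsGraphPair L v e ∧
      graphEnergy ω γ L v e =
        graphEnergy ω γ L u d - edgeEnergy ω (Ici R) u.h d.h + √ω * ‖u.h R‖ ^ 2 ∧
      graphQuartic L u - quartic (Ici R) u.h ≤ graphQuartic L v := by
  have hs := Real.sqrt_pos.2 hω
  have h1 : IsH1Pair (Icc 0 R) u.h d.h := h.half.mono Icc_subset_Ici_self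
  have h2 := expTail_isH1Pair hs R (u.h R)
  have hR' : u.h R = expTail (√ω) R (u.h R) R := by simp [expTail]
  have h3 := h1.glue h2 hR'
  have h30 : (Iic R).piecewise u.h (expTail (√ω) R (u.h R)) 0 = u.h 0 :=
    piecewise_eq_of_mem _ _ _ hR
  have hpair : IsGraphPair L ⟨u.c, (Iic R).piecewise u.h (expTail (√ω) R (u.h R))⟩
      ⟨d.c, (Iic R).piecewise d.h (fun x => -(√ω : ℝ) * expTail (√ω) R (u.h R) x)⟩ :=
    ⟨h.loop, h3, h.loop_eq, by dsimp only; rw [h30]; exact h.vertex_eq⟩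
  refine ⟨_, _, hpair, ?_, ?_⟩
  · have e1 := h1.edgeEnergy_glue h2 hR' hR ω
    have e2 := edgeEnergy_expTail hω R (u.h R)
    have e3 : edgeEnergy ω (Ici 0) u.h d.h =
        edgeEnergy ω (Icc 0 R) u.h d.h + edgeEnergy ω (Ici R) u.h d.h :=
      setIntegral_Ici_eq_add hR (h.half.integrable_energy ω)
    simp only [graphEnergy]
    rw [h30, e1, e2, e3]
    ring
  · have e1 := setIntegral_Ici_eq_add hR h.integrable_quartic_half
    have e2 : ∫ x in Icc 0 R, ‖u.h x‖ ^ 4 ≤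
        quartic (Ici 0) ((Iic R).piecewise u.h (expTail (√ω) R (u.h R))) := by
      have e3 : ∫ x in Icc 0 R, ‖u.h x‖ ^ 4 =
          ∫ x in Icc 0 R, ‖(Iic R).piecewise u.h (expTail (√ω) R (u.h R)) x‖ ^ 4 :=
        setIntegral_congr_fun measurableSet_Icc fun x hx => by
          rw [piecewise_eq_of_mem _ _ _ (show x ∈ Iic R from hx.2)]
      rw [e3]
      exact setIntegral_mono_set hpair.integrable_quartic_half
        (Eventually.of_forall fun x => by positivity) Icc_subset_Ici_self.eventuallyLE
    simp only [graphQuartic]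
    have e4 : quartic (Ici 0) u.h = (∫ x in Icc 0 R, ‖u.h x‖ ^ 4) + quartic (Ici R) u.h := e1
    linarith

end IsGraphPair

/-- There are functions on the graph which do not vanish. -/
theorem exists_isGraphPair_quartic_pos (hL : 0 < L) :
    ∃ u d, IsGraphPair L u d ∧ 0 < graphQuartic L u := by
  have h1 : IsH1Pair (Icc (-L) L) (fun _ => 1) (fun _ => 0) :=
    ⟨memLp_const 1, memLp_const 0, fun x _ y _ _ => by simp⟩
  refine ⟨⟨fun _ => 1, expTail 1 0 1⟩, ⟨fun _ => 0, _⟩,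
    ⟨h1, expTail_isH1Pair one_pos 0 1, rfl, by simp [expTail]⟩, ?_⟩
  have h2 : quartic (Icc (-L) L) (fun _ => 1) = 2 * L := by
    simp [quartic]
    rw [max_eq_left (by linarith)]
    ring
  have := quartic_nonneg (Ici 0) (expTail 1 0 1)
  rw [graphQuartic, h2]
  linarith

/-! ### The Nehari manifold and the action level -/

theorem exists_of_mem_nehariManifold (hω : 0 < ω) (hγ : 0 ≤ γ) (hL : 0 < L)
    (hu : u ∈ nehariManifold ω γ L) :
    ∃ d, IsGraphPair L u d ∧ graphEnergy ω γ L u d = 4 * u.action ω γ L ∧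
      graphQuartic L u = 4 * u.action ω γ L ∧ 0 < u.action ω γ L := by
  obtain ⟨h1, h2, h3⟩ := hu
  obtain ⟨d, hd⟩ := (mem_H1D_iff hL).1 h1
  rw [hd.nehari_eq] at h3
  have h4 := hd.action_eq (ω := ω) (γ := γ)
  have h5 : graphEnergy ω γ L u d ≠ 0 := fun h0 => h2 (hd.isZero_of_energy_eq_zero hω hγ h0)
  have h6 := lt_of_le_of_ne (graphEnergy_nonneg (L := L) (u := u) (d := d) hω.le hγ) h5.symm
  exact ⟨d, hd, by linarith, by linarith, by linarith⟩

theorem IsGraphPair.mem_nehariManifold (h : IsGraphPair L u d) (hL : 0 < L)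
    (hEP : graphEnergy ω γ L u d = graphQuartic L u) (hP : 0 < graphQuartic L u) :
    u ∈ nehariManifold ω γ L ∧ 4 * u.action ω γ L = graphEnergy ω γ L u d := by
  refine ⟨⟨(mem_H1D_iff hL).2 ⟨d, h⟩, not_isZero_of_quartic_pos hP, ?_⟩, ?_⟩
  · rw [h.nehari_eq, hEP, sub_self]
  · rw [h.action_eq]
    linarith

theorem bddBelow_action_image (hω : 0 < ω) (hγ : 0 ≤ γ) (hL : 0 < L) :
    BddBelow (action ω γ L '' nehariManifold ω γ L) := by
  refine ⟨0, ?_⟩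
  rintro _ ⟨u, hu, rfl⟩
  obtain ⟨d, -, -, -, h⟩ := exists_of_mem_nehariManifold hω hγ hL hu
  exact h.le

theorem actionLevel_le_action (hω : 0 < ω) (hγ : 0 ≤ γ) (hL : 0 < L)
    (hu : u ∈ nehariManifold ω γ L) : actionLevel ω γ L ≤ u.action ω γ L :=
  csInf_le (bddBelow_action_image hω hγ hL) ⟨u, hu, rfl⟩

/-- Rescaling onto the Nehari manifold. -/
theorem IsGraphPair.exists_smul_mem (h : IsGraphPair L u d) (hω : 0 < ω) (hγ : 0 ≤ γ) (hL : 0 < L)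
    (hP : 0 < graphQuartic L u) : ∃ v ∈ nehariManifold ω γ L,
      4 * v.action ω γ L * graphQuartic L u = graphEnergy ω γ L u d ^ 2 := by
  set E := graphEnergy ω γ L u d with hE
  set P := graphQuartic L u with hPdef
  have hE0 : 0 < E := by
    refine lt_of_le_of_ne (graphEnergy_nonneg hω.le hγ) fun h0 => ?_
    have := h.quartic_le_energy_sq hω hγ
    rw [← hE, ← h0] at this
    simp only [ne_eq, OfNat.ofNat_ne_zero, not_false_eq_true, zero_pow, mul_zero] at this
    linarith
  set z : ℂ := ((√(E / P) : ℝ) : ℂ)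
  have hz : ‖z‖ ^ 2 = E / P := by
    rw [Complex.norm_real, Real.norm_of_nonneg (Real.sqrt_nonneg _), Real.sq_sqrt (by positivity)]
  have hz4 : ‖z‖ ^ 4 = (E / P) ^ 2 := by rw [← hz]; ring
  have h1 : graphEnergy ω γ L (z • u) (z • d) = E ^ 2 / P := by
    rw [graphEnergy_smul, hz]; ring
  have h2 : graphQuartic L (z • u) = E ^ 2 / P := by
    rw [graphQuartic_smul, hz4, ← hPdef]; field_simp
  obtain ⟨h3, h4⟩ := (h.smul z).mem_nehariManifold hL (h1.trans h2.symm) (by rw [h2]; positivity)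
  exact ⟨_, h3, by rw [h4, h1]; field_simp⟩

/-- Without this, `sInf` could be the default value 0 of the empty set. -/
theorem nehariManifold_nonempty (hω : 0 < ω) (hγ : 0 ≤ γ) (hL : 0 < L) :
    (nehariManifold ω γ L).Nonempty := by
  obtain ⟨u, d, h, hP⟩ := exists_isGraphPair_quartic_pos hL
  obtain ⟨v, hv, -⟩ := h.exists_smul_mem hω hγ hL hP
  exact ⟨v, hv⟩

/-- The scale-invariant form of minimality: rescaling u onto the manifold yields action E²/(4P). It
applies to functions off the manifold, such as cut-offs and sums. -/
theorem IsGraphPair.actionLevel_mul_quartic_le (h : IsGraphPair L u d) (hω : 0 < ω) (hγ : 0 ≤ γ)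
    (hL : 0 < L) :
    4 * actionLevel ω γ L * graphQuartic L u ≤ graphEnergy ω γ L u d ^ 2 := by
  rcases (graphQuartic_nonneg (L := L) (u := u)).eq_or_lt with h0 | h0
  · rw [← h0, mul_zero]; positivity
  obtain ⟨v, hv, hvE⟩ := h.exists_smul_mem hω hγ hL h0
  rw [← hvE]
  have := actionLevel_le_action hω hγ hL hv
  gcongr

/-- On the manifold E = P = 4S, so P ≤ K·E² reads 4S ≤ 16K·S² and forces S ≥ 1/(4K). -/
theorem actionLevel_pos (hω : 0 < ω) (hγ : 0 ≤ γ) (hL : 0 < L) : 0 < actionLevel ω γ L := by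
  set K := (1 + 1 / ω) / ω
  have hK : 0 < K := by positivity
  refine lt_of_lt_of_le (show 0 < 1 / (4 * K) by positivity)
    (le_csInf ((nehariManifold_nonempty hω hγ hL).image _) ?_)
  rintro _ ⟨u, hu, rfl⟩
  obtain ⟨d, h1, h2, h3, h4⟩ := exists_of_mem_nehariManifold hω hγ hL hu
  have h5 := h1.quartic_le_energy_sq hω hγ
  rw [h2, h3] at h5
  rw [div_le_iff₀ (by positivity)]
  have h6 : u.action ω γ L * 1 ≤ u.action ω γ L * (u.action ω γ L * (4 * K)) := by
    nlinarith
  exact le_of_mul_le_mul_left h6 h4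

end TadpoleFun

/-! ### Tightness of almost minimizers -/

/-- The quantitative form of strict subadditivity. On 0 ≤ r ≤ t the convex function (t - r)² + θr²
lies below its chord t² - (1 - θ)tr, so a value close to t² forces r to be small. -/
theorem exists_pos_forall_remainder_le {T θ ε : ℝ} (hT : 0 < T) (hθ0 : 0 ≤ θ) (hθ : θ < 1)
    (hε : 0 < ε) : ∃ δ₀ > 0, ∀ t r δ : ℝ, T ≤ t → t ≤ T + δ₀ → 0 ≤ r → r ≤ t → 0 ≤ δ → δ ≤ δ₀ →
      T * t ≤ (t - r + δ) ^ 2 + θ * (r + δ) ^ 2 → r ≤ ε := by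
  have hθ' : 0 < 1 - θ := by linarith
  -- 6T + 9 collects the errors: 4T + 4 from A² - T², 2T + 4 from 2rδ and 1 from δ², with A = t + δ.
  refine ⟨min 1 (ε * ((1 - θ) * T) / (6 * T + 9)), by positivity,
    fun t r δ htT ht hr hrt hδ hδ₀ h => ?_⟩
  set δ₀ := min 1 (ε * ((1 - θ) * T) / (6 * T + 9)) with hδ₀_def
  have h1 : δ₀ ≤ 1 := min_le_left _ _
  have h2 : δ₀ * (6 * T + 9) ≤ ε * ((1 - θ) * T) := by
    rw [← le_div_iff₀ (by positivity)]; exact min_le_right _ _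
  have hδ₀p : 0 ≤ δ₀ := hδ.trans hδ₀
  set A := t + δ with hA
  have hAT : T ≤ A := by linarith
  have hAu : A ≤ T + 2 * δ₀ := by linarith
  have hrA : r ≤ A := by linarith
  have h3 : θ * (r + δ) ^ 2 ≤ θ * r ^ 2 + (2 * r * δ + δ ^ 2) := by
    have : 0 ≤ 2 * r * δ + δ ^ 2 := by positivity
    nlinarith
  have h4 : T ^ 2 ≤ T * t := by nlinarith
  have h5 : (1 + θ) * r ^ 2 ≤ (1 + θ) * (A * r) := by
    refine mul_le_mul_of_nonneg_left ?_ (by linarith)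
    nlinarith
  have h6 : (1 - θ) * (A * r) ≤ A ^ 2 - T ^ 2 + 2 * r * δ + δ ^ 2 := by
    have : t - r + δ = A - r := by rw [hA]; ring
    rw [this] at h
    nlinarith
  have h7 : 2 * r * δ ≤ 2 * (T + 2) * δ₀ := by
    have : r * δ ≤ (T + 2) * δ₀ := mul_le_mul (by linarith) hδ₀ hδ (by linarith)
    linarith
  have h8 : δ ^ 2 ≤ δ₀ := by nlinarith
  have h9 : A ^ 2 - T ^ 2 ≤ 2 * δ₀ * (2 * T + 2) := by
    have e : A ^ 2 - T ^ 2 = (A - T) * (A + T) := by ring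
    rw [e]
    exact mul_le_mul (by linarith) (by linarith) (by linarith) (by linarith)
  have h10 : (1 - θ) * T * r ≤ (1 - θ) * (A * r) := by
    rw [mul_assoc]
    exact mul_le_mul_of_nonneg_left (mul_le_mul_of_nonneg_right hAT hr) hθ'.le
  have h11 : r * ((1 - θ) * T) ≤ ε * ((1 - θ) * T) := by linarith
  exact le_of_mul_le_mul_right h11 (by positivity)

theorem exists_pos_one_add_pow_three_mul_lt {a b : ℝ} (hab : a < b) :
    ∃ s > 0, (1 + s) ^ 3 * a < b := by
  have h1 : Tendsto (fun s : ℝ => (1 + s) ^ 3 * a) (𝓝[>] 0) (𝓝 a) := by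
    have : Continuous fun s : ℝ => (1 + s) ^ 3 * a := by fun_prop
    have h2 := this.tendsto 0
    simp only [add_zero, one_pow, one_mul] at h2
    exact h2.mono_left nhdsWithin_le_nhds
  obtain ⟨s, hs, hs0⟩ := ((h1.eventually (eventually_lt_nhds hab)).and self_mem_nhdsWithin).exists
  exact ⟨s, hs0, hs⟩

theorem rpow_three_halves_eq {ω : ℝ} (hω : 0 ≤ ω) : ω ^ (3 / 2 : ℝ) = √ω ^ 3 := by
  rw [Real.sqrt_eq_rpow, ← Real.rpow_natCast, ← Real.rpow_mul hω]
  norm_num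

namespace TadpoleFun

variable {ω γ L : ℝ}

/-- Almost minimizers on the Nehari manifold have little energy beyond a point on the half-line at
which they are small. -/
theorem exists_pos_forall_tail_energy_le (hω : 0 < ω) (hγ : 0 ≤ γ) (hL : 0 < L)
    (hlevel : actionLevel ω γ L < 4 / 3 * ω ^ (3 / 2 : ℝ)) {ε : ℝ} (hε : 0 < ε) :
    ∃ δ₀ > 0, ∀ u d : TadpoleFun, IsGraphPair L u d →
      graphEnergy ω γ L u d = graphQuartic L u → 4 * actionLevel ω γ L ≤ graphEnergy ω γ L u d →
      graphEnergy ω γ L u d ≤ 4 * actionLevel ω γ L + δ₀ → ∀ R, 0 ≤ R → √ω * ‖u.h R‖ ^ 2 ≤ δ₀ →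
      edgeEnergy ω (Ici R) u.h d.h ≤ ε := by
  have hs := Real.sqrt_pos.2 hω
  rw [rpow_three_halves_eq hω.le] at hlevel
  set T := 4 * actionLevel ω γ L with hT_def
  have hT : 0 < T := mul_pos (by norm_num) (actionLevel_pos hω hγ hL)
  set σ := 16 / 3 * √ω ^ 3 with hσ_def
  have hσ : 0 < σ := by positivity
  have hTσ : T < σ := by linarith
  obtain ⟨δ₀, hδ₀, H⟩ := exists_pos_forall_remainder_le hT (θ := T / σ) (by positivity)
    ((div_lt_one hσ).2 hTσ) hε
  refine ⟨δ₀, hδ₀, fun u d h hEP hTE hET R hR hRδ => ?_⟩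
  refine H (graphEnergy ω γ L u d) _ (√ω * ‖u.h R‖ ^ 2) hTE hET (edgeEnergy_nonneg hω.le _ _ _)
    ((h.half.edgeEnergy_mono hω.le (Ici_subset_Ici.2 hR)).trans (edgeEnergy_half_le hω.le hγ))
    (by positivity) hRδ ?_
  -- The level inequality is applied to the cut function and the sharp half-line inequality to the
  -- removed tail; their sum bounds T·P(u) = T·E(u).
  obtain ⟨v, e, hv, hvE, hvP⟩ := h.exists_cut (γ := γ) hω hR
  have h1 := hv.actionLevel_mul_quartic_le hω hγ hL
  have h2 := (h.half.mono (Ici_subset_Ici.2 hR)).quartic_Ici_le hω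
  rw [hvE, ← hT_def] at h1
  rw [← hσ_def] at h2
  have h3 : T * quartic (Ici R) u.h ≤
      T / σ * (edgeEnergy ω (Ici R) u.h d.h + √ω * ‖u.h R‖ ^ 2) ^ 2 := by
    rw [div_mul_eq_mul_div, le_div_iff₀ hσ]
    have := mul_le_mul_of_nonneg_left h2 hT.le
    linarith
  have h4 := mul_le_mul_of_nonneg_left hvP hT.le
  rw [← hEP] at h4
  linarith

/-! ### Convergence of minimizing sequences -/

/-- `u n` is a minimizing sequence on the Nehari manifold, with derivatives `d n`. -/
structure IsMinimizing (ω γ L : ℝ) (u d : ℕ → TadpoleFun) : Prop where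
  pair : ∀ n, IsGraphPair L (u n) (d n)
  energy_eq : ∀ n, graphEnergy ω γ L (u n) (d n) = graphQuartic L (u n)
  le_energy : ∀ n, 4 * actionLevel ω γ L ≤ graphEnergy ω γ L (u n) (d n)
  tendsto : Tendsto (fun n => graphEnergy ω γ L (u n) (d n)) atTop (𝓝 (4 * actionLevel ω γ L))

theorem exists_isMinimizing (hω : 0 < ω) (hγ : 0 ≤ γ) (hL : 0 < L) :
    ∃ u d, IsMinimizing ω γ L u d := by
  obtain ⟨a, -, ha, haS⟩ := exists_seq_tendsto_sInf
    ((nehariManifold_nonempty hω hγ hL).image (action ω γ L)) (bddBelow_action_image hω hγ hL)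
  choose u hu hua using haS
  choose d hd hE hP hpos using fun n => exists_of_mem_nehariManifold hω hγ hL (hu n)
  refine ⟨u, d, hd, fun n => (hE n).trans (hP n).symm, fun n => ?_, ?_⟩
  · rw [hE]
    have := actionLevel_le_action hω hγ hL (hu n)
    linarith
  · simp only [hE, hua]
    exact ha.const_mul 4

namespace IsMinimizing

variable {u d : ℕ → TadpoleFun}

theorem subseq (h : IsMinimizing ω γ L u d) {φ : ℕ → ℕ} (hφ : StrictMono φ) :
    IsMinimizing ω γ L (fun n => u (φ n)) (fun n => d (φ n)) :=
  ⟨fun _ => h.pair _, fun _ => h.energy_eq _, fun _ => h.le_energy _,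
    h.tendsto.comp hφ.tendsto_atTop⟩

theorem exists_energy_le (h : IsMinimizing ω γ L u d) :
    ∃ B, ∀ n, graphEnergy ω γ L (u n) (d n) ≤ B := by
  obtain ⟨B, hB⟩ := h.tendsto.bddAbove_range
  exact ⟨B, fun n => hB ⟨n, rfl⟩⟩

theorem exists_subseq_tendsto (h : IsMinimizing ω γ L u d) (hω : 0 < ω) (hγ : 0 ≤ γ) :
    ∃ φ : ℕ → ℕ, StrictMono φ ∧ ∃ v : TadpoleFun,
      (∀ x ∈ Icc (-L) L, Tendsto (fun n => (u (φ n)).c x) atTop (𝓝 (v.c x))) ∧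
      ∀ x ∈ Ici (0 : ℝ), Tendsto (fun n => (u (φ n)).h x) atTop (𝓝 (v.h x)) := by
  obtain ⟨B, hB⟩ := h.exists_energy_le
  have hK : 0 ≤ 1 + 1 / ω := by positivity
  obtain ⟨φ, hφ, F, hF⟩ := IsH1Pair.exists_subseq_tendsto (fun n => (h.pair n).loop)
    (fun n x hx => ((h.pair n).norm_sq_loop_le hω hγ x hx).trans
      (mul_le_mul_of_nonneg_left (hB n) hK))
    (fun n => ((h.pair n).loop.integral_deriv_sq_le hω.le).trans
      ((edgeEnergy_loop_le hω.le hγ).trans (hB n)))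
  obtain ⟨ψ, hψ, G, hG⟩ := IsH1Pair.exists_subseq_tendsto (fun n => (h.pair (φ n)).half)
    (fun n x hx => ((h.pair (φ n)).norm_sq_half_le hω hγ x hx).trans
      (mul_le_mul_of_nonneg_left (hB (φ n)) hK))
    (fun n => ((h.pair (φ n)).half.integral_deriv_sq_le hω.le).trans
      ((edgeEnergy_half_le hω.le hγ).trans (hB (φ n))))
  exact ⟨φ ∘ ψ, hφ.comp hψ, ⟨F, G⟩, fun x hx => (hF x hx).comp hψ.tendsto_atTop, hG⟩

/-- Below the level of the line soliton, minimizing sequences are tight. -/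
theorem exists_tail_quartic_le (h : IsMinimizing ω γ L u d) (hω : 0 < ω) (hγ : 0 ≤ γ) (hL : 0 < L)
    (hlevel : actionLevel ω γ L < 4 / 3 * ω ^ (3 / 2 : ℝ)) {ε : ℝ} (hε : 0 < ε) :
    ∃ R ≥ 0, ∃ N, ∀ n ≥ N, quartic (Ici R) (u n).h ≤ ε := by
  have hs := Real.sqrt_pos.2 hω
  obtain ⟨B, hB⟩ := h.exists_energy_le
  have hB0 : 0 ≤ B := (graphEnergy_nonneg hω.le hγ).trans (hB 0)
  set σ := 16 / 3 * √ω ^ 3 with hσ_def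
  have hσ : 0 < σ := by positivity
  -- Chosen so that (2η)² ≤ 4η ≤ σε.
  set η := min 1 (σ * ε / 4) with hη_def
  have hη : 0 < η := by positivity
  obtain ⟨δ₀, hδ₀, H⟩ := exists_pos_forall_tail_energy_le hω hγ hL hlevel hη
  set κ := min δ₀ η
  have hκ : 0 < κ := by positivity
  -- Since ∫‖u‖² ≤ B/ω, a window of this length contains a point y with √ω‖u(y)‖² ≤ κ. The point
  -- depends on n, but y ≤ R, so the tail beyond R is controlled by the one beyond y.
  set R := √ω * (B / ω + 1) / κ with hR_def
  have hR : 0 ≤ R := by positivity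
  obtain ⟨N, hN⟩ := eventually_atTop.1 (h.tendsto.eventually
    (eventually_le_nhds (show 4 * actionLevel ω γ L < 4 * actionLevel ω γ L + δ₀ by linarith)))
  refine ⟨R, hR, N, fun n hn => ?_⟩
  have hp := h.pair n
  obtain ⟨y, hy, hyR⟩ := hp.half.exists_mul_norm_sq_le hR (x := 0) self_mem_Ici
    (by rw [zero_add]; exact hR)
  rw [zero_add] at hy hyR
  have h1 : ∫ t in Icc 0 R, ‖(u n).h t‖ ^ 2 ≤ B / ω := by
    have e1 : ∫ t in Icc 0 R, ‖(u n).h t‖ ^ 2 ≤ ∫ t in Ici (0 : ℝ), ‖(u n).h t‖ ^ 2 :=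
      setIntegral_mono_set hp.half.integrable_sq (Eventually.of_forall fun t => by positivity)
        Icc_subset_Ici_self.eventuallyLE
    have e2 := hp.half.integral_sq_le hω
    have e3 : edgeEnergy ω (Ici 0) (u n).h (d n).h / ω ≤ B / ω := by
      have := (edgeEnergy_half_le (u := u n) (d := d n) (L := L) hω.le hγ).trans (hB n)
      gcongr
    linarith
  have h2 : √ω * ‖(u n).h y‖ ^ 2 ≤ κ := by
    have e1 : R * ‖(u n).h y‖ ^ 2 ≤ B / ω + 1 := by linarith
    rw [hR_def, div_mul_eq_mul_div, div_le_iff₀ hκ] at e1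
    have e2 : (B / ω + 1) * (√ω * ‖(u n).h y‖ ^ 2) ≤ (B / ω + 1) * κ := by linarith
    exact le_of_mul_le_mul_left e2 (by positivity)
  have h3 := H (u n) (d n) hp (h.energy_eq n) (h.le_energy n) (hN n hn) y hy.1
    (h2.trans (min_le_left _ _))
  have h4 := (hp.half.mono (Ici_subset_Ici.2 hy.1)).quartic_Ici_le hω
  rw [← hσ_def] at h4
  have h5 : quartic (Ici R) (u n).h ≤ quartic (Ici y) (u n).h :=
    setIntegral_mono_set (hp.integrable_quartic_half.mono_set (Ici_subset_Ici.2 hy.1))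
      (Eventually.of_forall fun t => by positivity) (Ici_subset_Ici.2 hy.2).eventuallyLE
  have h6 : edgeEnergy ω (Ici y) (u n).h (d n).h + √ω * ‖(u n).h y‖ ^ 2 ≤ 2 * η := by
    have := h2.trans (min_le_right δ₀ η)
    linarith
  have h7 : 0 ≤ edgeEnergy ω (Ici y) (u n).h (d n).h + √ω * ‖(u n).h y‖ ^ 2 :=
    add_nonneg (edgeEnergy_nonneg hω.le _ _ _) (by positivity)
  have h8 : (2 * η) ^ 2 ≤ σ * ε := by
    have e1 : η ≤ 1 := min_le_left _ _
    have e2 : η ≤ σ * ε / 4 := min_le_right _ _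
    nlinarith
  have h9 : σ * quartic (Ici y) (u n).h ≤ σ * ε :=
    h4.trans ((pow_le_pow_left₀ h7 h6 2).trans h8)
  exact h5.trans (le_of_mul_le_mul_left h9 hσ)

theorem quartic_sub_cauchy (h : IsMinimizing ω γ L u d) (hω : 0 < ω) (hγ : 0 ≤ γ) (hL : 0 < L)
    (hlevel : actionLevel ω γ L < 4 / 3 * ω ^ (3 / 2 : ℝ)) {v : TadpoleFun}
    (hc : ∀ x ∈ Icc (-L) L, Tendsto (fun n => (u n).c x) atTop (𝓝 (v.c x)))
    (hh : ∀ x ∈ Ici (0 : ℝ), Tendsto (fun n => (u n).h x) atTop (𝓝 (v.h x))) {ε : ℝ}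
    (hε : 0 < ε) : ∃ N, ∀ n ≥ N, ∀ m ≥ N, graphQuartic L (u n - u m) ≤ ε := by
  obtain ⟨B, hB⟩ := h.exists_energy_le
  have hK : 0 ≤ 1 + 1 / ω := by positivity
  obtain ⟨R, hR, N₁, hN₁⟩ := h.exists_tail_quartic_le hω hγ hL hlevel
    -- The quartic inequality with t = 1 has factor 8 on each of the two tails, and 16/48 = 1/3.
    (show 0 < ε / 48 by positivity)
  obtain ⟨N₂, hN₂⟩ := quartic_sub_tendsto_zero (K := Icc (-L) L) measurableSet_Icc (by simp)
    (fun n => (h.pair n).loop.memLp.1)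
    (fun n x hx => ((h.pair n).norm_sq_loop_le hω hγ x hx).trans
      (mul_le_mul_of_nonneg_left (hB n) hK)) hc (ε / 3) (by positivity)
  obtain ⟨N₃, hN₃⟩ := quartic_sub_tendsto_zero (K := Icc 0 R) measurableSet_Icc (by simp)
    (fun n => ((h.pair n).half.mono Icc_subset_Ici_self).memLp.1)
    (fun n x hx => ((h.pair n).norm_sq_half_le hω hγ x hx.1).trans
      (mul_le_mul_of_nonneg_left (hB n) hK)) (fun x hx => hh x hx.1) (ε / 3) (by positivity)
  refine ⟨max N₁ (max N₂ N₃), fun n hn m hm => ?_⟩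
  simp only [ge_iff_le, max_le_iff] at hn hm
  have h2 := hN₂ n hn.2.1 m hm.2.1
  have h3 := hN₃ n hn.2.2 m hm.2.2
  have h1 : quartic (Ici R) (fun x => (u n).h x - (u m).h x) ≤ ε / 3 := by
    have e0 : ∀ k, IntegrableOn (fun x => ‖(u k).h x‖ ^ 4) (Ici R) := fun k =>
      (h.pair k).integrable_quartic_half.mono_set (Ici_subset_Ici.2 hR)
    have e1 := quartic_add_le (f' := fun x => -(u m).h x) (e0 n)
      (by simpa only [norm_neg] using e0 m) one_pos
    have e2 : quartic (Ici R) (fun x => -(u m).h x) = quartic (Ici R) (u m).h := by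
      simp only [quartic, norm_neg]
    rw [e2] at e1
    simp only [← sub_eq_add_neg] at e1
    have := hN₁ n hn.1
    have := hN₁ m hm.1
    linarith
  have h4 := setIntegral_Ici_eq_add hR ((h.pair n).sub (h.pair m)).integrable_quartic_half
  change quartic (Icc (-L) L) (fun x => (u n).c x - (u m).c x) +
    quartic (Ici 0) (fun x => (u n).h x - (u m).h x) ≤ ε
  change quartic (Ici 0) (fun x => (u n).h x - (u m).h x) =
    quartic (Icc 0 R) (fun x => (u n).h x - (u m).h x) +
    quartic (Ici R) (fun x => (u n).h x - (u m).h x) at h4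
  linarith

/-- By the parallelogram law, a minimizing sequence which is Cauchy in `L⁴` is Cauchy in `H¹`. -/
theorem energy_sub_cauchy (h : IsMinimizing ω γ L u d) (hω : 0 < ω) (hγ : 0 ≤ γ) (hL : 0 < L)
    (hq : ∀ ε > 0, ∃ N, ∀ n ≥ N, ∀ m ≥ N, graphQuartic L (u n - u m) ≤ ε) {ε : ℝ} (hε : 0 < ε) :
    ∃ N, ∀ n ≥ N, ∀ m ≥ N, graphEnergy ω γ L (u n - u m) (d n - d m) ≤ ε := by
  set T := 4 * actionLevel ω γ L with hT_def
  have hT : 0 < T := mul_pos (by norm_num) (actionLevel_pos hω hγ hL)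
  -- For such large ε the parallelogram law alone suffices. Otherwise 4T - ε/2 ≥ 0, and squaring
  -- preserves the strict inequality with 4T.
  by_cases hεT : 4 * T - ε / 2 < 0
  · obtain ⟨N, hN⟩ := eventually_atTop.1 (h.tendsto.eventually
      (eventually_le_nhds (show T < T + ε / 8 by linarith)))
    refine ⟨N, fun n hn m hm => ?_⟩
    have h1 := (h.pair n).energy_parallelogram (ω := ω) (γ := γ) (h.pair m)
    have h2 : 0 ≤ graphEnergy ω γ L (u n + u m) (d n + d m) := graphEnergy_nonneg hω.le hγ
    have := hN n hn
    have := hN m hm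
    linarith
  push Not at hεT
  have hlt : (4 * T - ε / 2) ^ 2 < 16 * T ^ 2 := by nlinarith
  obtain ⟨s, hs, hsT⟩ := exists_pos_one_add_pow_three_mul_lt hlt
  set C := (1 + 1 / s) ^ 3
  have hC : 0 < C := by positivity
  -- The gap in T·P(2uₙ) if E(uₙ - uₘ) > ε. Half of it absorbs the L⁴ difference, whose factor C is
  -- fixed once s is.
  set ρ := 16 * T ^ 2 - (1 + s) ^ 3 * (4 * T - ε / 2) ^ 2 with hρ
  have hρ0 : 0 < ρ := by linarith
  obtain ⟨N₁, hN₁⟩ := eventually_atTop.1 (h.tendsto.eventually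
    (eventually_le_nhds (show T < T + ε / 8 by linarith)))
  obtain ⟨N₂, hN₂⟩ := hq (ρ / (2 * T * C)) (by positivity)
  refine ⟨max N₁ N₂, fun n hn m hm => ?_⟩
  simp only [ge_iff_le, max_le_iff] at hn hm
  by_contra hlarge
  push Not at hlarge
  have h1 := (h.pair n).energy_parallelogram (ω := ω) (γ := γ) (h.pair m)
  have hadd := (h.pair n).add (h.pair m)
  have hsub := (h.pair n).sub (h.pair m)
  set Y := graphEnergy ω γ L (u n + u m) (d n + d m)
  have hY0 : 0 ≤ Y := graphEnergy_nonneg hω.le hγ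
  have hY : Y ≤ 4 * T - ε / 2 := by
    have := hN₁ n hn.1
    have := hN₁ m hm.1
    linarith
  have h2 := hadd.actionLevel_mul_quartic_le hω hγ hL
  have h3 := hadd.quartic_add_le hsub hs
  have h4 : u n + u m + (u n - u m) = (2 : ℂ) • u n := by
    change TadpoleFun.mk (fun x => (u n).c x + (u m).c x + ((u n).c x - (u m).c x))
      (fun x => (u n).h x + (u m).h x + ((u n).h x - (u m).h x)) =
      TadpoleFun.mk (fun x => 2 * (u n).c x) (fun x => 2 * (u n).h x)
    congr 1 <;> · ext x; ring
  rw [h4, graphQuartic_smul, ← h.energy_eq, Complex.norm_ofNat] at h3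
  have h5 := h.le_energy n
  have h6 := hN₂ n hn.2 m hm.2
  rw [← hT_def] at h2 h5
  have h7 : C * graphQuartic L (u n - u m) * T ≤ ρ / 2 := by
    have e1 := mul_le_mul_of_nonneg_left h6 (show 0 ≤ C * T by positivity)
    have e2 : C * T * (ρ / (2 * T * C)) = ρ / 2 := by field_simp
    linarith
  have h8 : (1 + s) ^ 3 * (T * graphQuartic L (u n + u m)) ≤
      (1 + s) ^ 3 * (4 * T - ε / 2) ^ 2 := by
    refine mul_le_mul_of_nonneg_left (h2.trans ?_) (by positivity)
    exact pow_le_pow_left₀ hY0 hY 2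
  have h9 : 16 * T * T ≤ ((1 + s) ^ 3 * graphQuartic L (u n + u m) +
      C * graphQuartic L (u n - u m)) * T :=
    mul_le_mul_of_nonneg_right (by linarith) hT.le
  nlinarith

theorem exists_limit (h : IsMinimizing ω γ L u d) (hω : 0 < ω) (hγ : 0 ≤ γ) (hL : 0 < L)
    (hC : ∀ ε > 0, ∃ N, ∀ n ≥ N, ∀ m ≥ N, graphEnergy ω γ L (u n - u m) (d n - d m) ≤ ε)
    {v : TadpoleFun} (hc : ∀ x ∈ Icc (-L) L, Tendsto (fun n => (u n).c x) atTop (𝓝 (v.c x)))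
    (hh : ∀ x ∈ Ici (0 : ℝ), Tendsto (fun n => (u n).h x) atTop (𝓝 (v.h x))) :
    ∃ e, IsGraphPair L v e ∧
      Tendsto (fun n => graphEnergy ω γ L (u n - v) (d n - e)) atTop (𝓝 0) := by
  obtain ⟨ec, hec, hec0⟩ := IsH1Pair.exists_limit measurableSet_Icc hω
    (fun n => (h.pair n).loop) hc fun ε hε => by
      obtain ⟨N, hN⟩ := hC ε hε
      exact ⟨N, fun n hn m hm => (edgeEnergy_loop_le (u := u n - u m) (d := d n - d m)
        hω.le hγ).trans (hN n hn m hm)⟩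
  obtain ⟨eh, heh, heh0⟩ := IsH1Pair.exists_limit measurableSet_Ici hω
    (fun n => (h.pair n).half) hh fun ε hε => by
      obtain ⟨N, hN⟩ := hC ε hε
      exact ⟨N, fun n hn m hm => (edgeEnergy_half_le (u := u n - u m) (d := d n - d m)
        (L := L) hω.le hγ).trans (hN n hn m hm)⟩
  have hl : L ∈ Icc (-L) L := ⟨by linarith, le_rfl⟩
  have hl' : -L ∈ Icc (-L) L := ⟨le_rfl, by linarith⟩
  refine ⟨⟨ec, eh⟩, ⟨hec, heh, ?_, ?_⟩, ?_⟩
  · exact tendsto_nhds_unique (hc L hl) ((hc (-L) hl').congr fun n => (h.pair n).loop_eq.symm)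
  · exact tendsto_nhds_unique (hc (-L) hl')
      ((hh 0 self_mem_Ici).congr fun n => (h.pair n).vertex_eq.symm)
  · have h1 : Tendsto (fun n => γ * ‖(u n).h 0 - v.h 0‖ ^ 2) atTop (𝓝 0) := by
      have e1 := (tendsto_iff_norm_sub_tendsto_zero.1 (hh 0 self_mem_Ici)).pow 2
      simpa using e1.const_mul γ
    have h2 := (hec0.add heh0).add h1
    simp only [add_zero] at h2
    exact h2

/-- Passing to the limit with the parametrized inequalities gives E(v) ≤ T and P(v) ≥ T. Then T² ≤
T·P(v) ≤ E(v)² ≤ T² forces equality throughout. -/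
theorem energy_eq_of_tendsto (h : IsMinimizing ω γ L u d) (hω : 0 < ω) (hγ : 0 ≤ γ) (hL : 0 < L)
    {v e : TadpoleFun} (hv : IsGraphPair L v e)
    (hlim : Tendsto (fun n => graphEnergy ω γ L (u n - v) (d n - e)) atTop (𝓝 0)) :
    graphEnergy ω γ L v e = 4 * actionLevel ω γ L ∧ graphQuartic L v = 4 * actionLevel ω γ L := by
  set T := 4 * actionLevel ω γ L with hT_def
  have hT : 0 < T := mul_pos (by norm_num) (actionLevel_pos hω hγ hL)
  have hneg : ∀ n, (-1 : ℂ) • (u n - v) + u n = v := fun n => by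
    change TadpoleFun.mk (fun x => -1 * ((u n).c x - v.c x) + (u n).c x)
      (fun x => -1 * ((u n).h x - v.h x) + (u n).h x) = v
    cases v
    congr 1 <;> · ext x; ring
  have hneg' : ∀ n, (-1 : ℂ) • (d n - e) + d n = e := fun n => by
    change TadpoleFun.mk (fun x => -1 * ((d n).c x - e.c x) + (d n).c x)
      (fun x => -1 * ((d n).h x - e.h x) + (d n).h x) = e
    cases e
    congr 1 <;> · ext x; ring
  have hpos : ∀ n, v + (u n - v) = u n := fun n => by
    change TadpoleFun.mk (fun x => v.c x + ((u n).c x - v.c x))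
      (fun x => v.h x + ((u n).h x - v.h x)) = u n
    cases u n
    congr 1 <;> · ext x; simp
  have hE : graphEnergy ω γ L v e ≤ T := by
    have key : ∀ s > 0, graphEnergy ω γ L v e ≤ (1 + 1 / s) * T := by
      intro s hs
      have h1 : Tendsto (fun n => (1 + s) * graphEnergy ω γ L (u n - v) (d n - e) +
          (1 + 1 / s) * graphEnergy ω γ L (u n) (d n)) atTop (𝓝 ((1 + 1 / s) * T)) := by
        simpa using (hlim.const_mul (1 + s)).add (h.tendsto.const_mul (1 + 1 / s))
      refine ge_of_tendsto' h1 fun n => ?_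
      have h2 := ((((h.pair n).sub hv).smul (-1)).energy_add_le (h.pair n) hω.le hγ hs)
      rw [hneg, hneg', graphEnergy_smul] at h2
      simpa using h2
    refine le_of_forall_pos_le_add fun ε hε => ?_
    -- With s = T/ε, the factor 1 + 1/s turns T into T + ε.
    have := key (T / ε) (by positivity)
    have e1 : (1 + 1 / (T / ε)) * T = T + ε := by field_simp
    linarith
  have hP : T ≤ graphQuartic L v := by
    have key : ∀ s > 0, T ≤ (1 + s) ^ 3 * graphQuartic L v := by
      intro s hs
      set K := (1 + 1 / ω) / ω
      have h1 : Tendsto (fun n => (1 + s) ^ 3 * graphQuartic L v +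
          (1 + 1 / s) ^ 3 * (K * graphEnergy ω γ L (u n - v) (d n - e) ^ 2)) atTop
          (𝓝 ((1 + s) ^ 3 * graphQuartic L v)) := by
        simpa using (((hlim.pow 2).const_mul K).const_mul ((1 + 1 / s) ^ 3)).const_add
          ((1 + s) ^ 3 * graphQuartic L v)
      refine ge_of_tendsto' h1 fun n => ?_
      have hsub := (h.pair n).sub hv
      have h2 := hv.quartic_add_le hsub hs
      rw [hpos, ← h.energy_eq] at h2
      have h3 := mul_le_mul_of_nonneg_left (hsub.quartic_le_energy_sq hω hγ)
        (show 0 ≤ (1 + 1 / s) ^ 3 by positivity)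
      have h4 := h.le_energy n
      linarith
    by_contra hlt
    push Not at hlt
    obtain ⟨s, hs, hsT⟩ := exists_pos_one_add_pow_three_mul_lt hlt
    exact absurd (key s hs) (not_le.2 hsT)
  have hA := hv.actionLevel_mul_quartic_le hω hγ hL
  rw [← hT_def] at hA
  have hE0 : 0 ≤ graphEnergy ω γ L v e := graphEnergy_nonneg hω.le hγ
  have hET : T ≤ graphEnergy ω γ L v e := by
    refine le_of_sq_le_sq ?_ hE0
    nlinarith
  refine ⟨le_antisymm hE hET, le_antisymm ?_ hP⟩
  have : T * graphQuartic L v ≤ T * T := hA.trans (by nlinarith)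
  exact le_of_mul_le_mul_left this hT

end IsMinimizing

end TadpoleFun

theorem lemma3p1 (ω γ L : ℝ) (hω : 0 < ω) (hγ : 0 < γ) (hL : 0 < L)
    (hlevel : TadpoleFun.actionLevel ω γ L < 4 / 3 * ω ^ (3 / 2 : ℝ)) :
    ∃ u ∈ TadpoleFun.nehariManifold ω γ L,
      TadpoleFun.action ω γ L u = TadpoleFun.actionLevel ω γ L ∧
      ∀ v ∈ TadpoleFun.nehariManifold ω γ L,
        TadpoleFun.action ω γ L u ≤ TadpoleFun.action ω γ L v := by
  obtain ⟨u₀, d₀, h₀⟩ := TadpoleFun.exists_isMinimizing hω hγ.le hL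
  obtain ⟨φ, hφ, v, hc, hh⟩ := h₀.exists_subseq_tendsto hω hγ.le
  have h := h₀.subseq hφ
  obtain ⟨e, hv, hlim⟩ := h.exists_limit hω hγ.le hL
    (fun ε hε => h.energy_sub_cauchy hω hγ.le hL
      (fun ε hε => h.quartic_sub_cauchy hω hγ.le hL hlevel hc hh hε) hε) hc hh
  obtain ⟨hE, hP⟩ := h.energy_eq_of_tendsto hω hγ.le hL hv hlim
  obtain ⟨hmem, hact⟩ := hv.mem_nehariManifold hL (hE.trans hP.symm) (by
    rw [hP]; exact mul_pos (by norm_num) (TadpoleFun.actionLevel_pos hω hγ.le hL))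
  have hS : v.action ω γ L = TadpoleFun.actionLevel ω γ L := by linarith
  exact ⟨v, hmem, hS, fun w hw => hS ▸ TadpoleFun.actionLevel_le_action hω hγ.le hL hw⟩
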